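/- Let $M$ be a compact flat Riemannian manifold, that is, a compact (Hausdorff, smooth, not necessarily connected) manifold with a smooth Riemannian metric that is locally isometric to Euclidean space. A distribution on $M$ is a smooth vector subbundle $D$ of $TM$ (of locally constant rank); it is parallel if $\nabla_XY$ is a section of $D$ for every local section $Y$ of $D$ and every local vector field $X$, where $\nabla$ is the Levi-Civita connection. The leaves of $D$ are its maximal connected integral manifolds, i.e. the maximal connected, injectively immersed submanifolds of $M$ whose tangent spaces are the fibres of $D$; a leaf is called compact if it is compact in its own manifold topology. Then the class of parallel distributions on $M$ all of whose leaves are compact is closed under spans and intersections: if $(D_j)_{j\in J}$ is any family of parallel distributions on $M$ all of whose leaves are compact, then both the span $x\mapsto\sum_{j\in J}(D_j)_x$ and the intersection $x\mapsto\bigcap_{j\in J}(D_j)_x$ are (smooth) parallel distributions on $M$ all of whose leaves are compact. (For $J=\emptyset$ these are the zero distribution and $TM$.) -/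

import Mathlib

open scoped Manifold ContDiff Bundle
open Bundle

universe u

noncomputable section

namespace FlatManifold

variable {n : ℕ} {M : Type u} [TopologicalSpace M] [ChartedSpace (EuclideanSpace ℝ (Fin n)) M]

/-- The vector field `X` is smooth on the set `U`. -/
def SmoothFieldOn [IsManifold (𝓡 n) ∞ M] (X : (x : M) → TangentSpace (𝓡 n) x) (U : Set M) :
    Prop :=
  ContMDiffOn (𝓡 n) ((𝓡 n).prod (𝓡 n)) ∞
    (fun x => TotalSpace.mk' (EuclideanSpace ℝ (Fin n)) x (X x)) U

section Riemannian

variable [IsManifold (𝓡 n) ∞ M] [RiemannianBundle (fun x : M => TangentSpace (𝓡 n) x)]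

variable (n M) in
/-- A Riemannian manifold is flat if it is locally isometric to Euclidean space: every point lies
in the domain of a smooth chart whose differentials are linear isometries onto `ℝⁿ` with its
standard inner product. -/
def IsFlat : Prop :=
  ∀ x : M, ∃ e ∈ IsManifold.maximalAtlas (𝓡 n) ∞ M, x ∈ e.source ∧
    ∀ y ∈ e.source, ∀ v w : TangentSpace (𝓡 n) y,
      inner ℝ (mfderiv (𝓡 n) (𝓡 n) e y v : EuclideanSpace ℝ (Fin n))
        (mfderiv (𝓡 n) (𝓡 n) e y w : EuclideanSpace ℝ (Fin n)) = inner ℝ v w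

/-- The right-hand side of the Koszul formula, that is, `⟨∇_X Y, Z⟩` at `x` for the Levi-Civita
connection `∇` of the Riemannian metric. -/
def koszul (X Y Z : (x : M) → TangentSpace (𝓡 n) x) (x : M) : ℝ :=
  (1 / 2) *
    (mvfderiv (𝓡 n) (fun y => inner ℝ (Y y) (Z y)) x (X x)
      + mvfderiv (𝓡 n) (fun y => inner ℝ (Z y) (X y)) x (Y x)
      - mvfderiv (𝓡 n) (fun y => inner ℝ (X y) (Y y)) x (Z x)
      + inner ℝ (VectorField.mlieBracket (𝓡 n) X Y x) (Z x)
      - inner ℝ (VectorField.mlieBracket (𝓡 n) Y Z x) (X x)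
      + inner ℝ (VectorField.mlieBracket (𝓡 n) Z X x) (Y x))

instance (x : M) : FiniteDimensional ℝ (TangentSpace (𝓡 n) x) :=
  inferInstanceAs (FiniteDimensional ℝ (EuclideanSpace ℝ (Fin n)))

/-- The Levi-Civita covariant derivative `∇_X Y` at `x`: its components in an orthonormal basis
`b i` of the tangent space are `⟨∇_X Y, b i⟩`, given by the Koszul formula applied to local
extensions of the vectors `b i`. -/
def leviCivita (X Y : (x : M) → TangentSpace (𝓡 n) x) (x : M) : TangentSpace (𝓡 n) x :=
  ∑ i, koszul X Y
      (FiberBundle.extend (EuclideanSpace ℝ (Fin n))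
        (stdOrthonormalBasis ℝ (TangentSpace (𝓡 n) x) i)) x
    • stdOrthonormalBasis ℝ (TangentSpace (𝓡 n) x) i

/-- `D` is parallel: the Levi-Civita covariant derivative of every local smooth section of `D`,
in the direction of any local smooth vector field, is again a section of `D`. -/
def IsParallel (D : (x : M) → Submodule ℝ (TangentSpace (𝓡 n) x)) : Prop :=
  ∀ (U : Set M) (X Y : (x : M) → TangentSpace (𝓡 n) x), IsOpen U →
    SmoothFieldOn X U → SmoothFieldOn Y U → (∀ y ∈ U, Y y ∈ D y) →
    ∀ x ∈ U, leviCivita X Y x ∈ D x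

end Riemannian

/-- A (smooth) distribution: a family `D` of subspaces of the tangent spaces that is a smooth
vector subbundle of the tangent bundle, i.e. near each point `D` has a smooth frame. (The rank is
then locally constant.) -/
def IsDistribution [IsManifold (𝓡 n) ∞ M]
    (D : (x : M) → Submodule ℝ (TangentSpace (𝓡 n) x)) : Prop :=
  ∀ x : M, ∃ (U : Set M) (k : ℕ) (Y : Fin k → (y : M) → TangentSpace (𝓡 n) y),
    IsOpen U ∧ x ∈ U ∧ (∀ i, SmoothFieldOn (Y i) U) ∧
    ∀ y ∈ U, LinearIndependent ℝ (fun i => Y i y) ∧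
      Submodule.span ℝ (Set.range fun i => Y i y) = D y

/-- `ι : N → M` is a connected integral manifold of `D`: a connected (nonempty) smooth manifold
`N` with an injective immersion `ι` into `M`, whose tangent spaces are the spaces of `D`. The
topology of `N` need not be that of a subset of `M`. When `M` is Hausdorff and has a Riemannian
metric, such an `N` is automatically Hausdorff and second countable. -/
structure IsConnectedIntegralManifold (D : (x : M) → Submodule ℝ (TangentSpace (𝓡 n) x))
    (k : ℕ) {N : Type u} [TopologicalSpace N] [ChartedSpace (EuclideanSpace ℝ (Fin k)) N]
    (ι : N → M) : Prop where
  isManifold : IsManifold (𝓡 k) ∞ N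
  connected : ConnectedSpace N
  smooth : ContMDiff (𝓡 k) (𝓡 n) ∞ ι
  injective : Function.Injective ι
  immersion : ∀ p, Function.Injective (mfderiv (𝓡 k) (𝓡 n) ι p)
  tangent : ∀ p, LinearMap.range (mfderiv (𝓡 k) (𝓡 n) ι p).toLinearMap = D (ι p)

/-- A leaf of `D`: a connected integral manifold that is maximal, i.e. not properly contained in
another one. -/
structure IsLeaf (D : (x : M) → Submodule ℝ (TangentSpace (𝓡 n) x))
    (k : ℕ) {N : Type u} [TopologicalSpace N] [ChartedSpace (EuclideanSpace ℝ (Fin k)) N]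
    (ι : N → M) : Prop extends IsConnectedIntegralManifold D k ι where
  maximal : ∀ {l : ℕ} {N' : Type u} [TopologicalSpace N']
    [ChartedSpace (EuclideanSpace ℝ (Fin l)) N'] (ι' : N' → M),
    IsConnectedIntegralManifold D l ι' → Set.range ι ⊆ Set.range ι' → Set.range ι' = Set.range ι

/-- All leaves of `D` are compact, in their own topologies. -/
def AllLeavesCompact (D : (x : M) → Submodule ℝ (TangentSpace (𝓡 n) x)) : Prop :=
  ∀ (k : ℕ) (N : Type u) [TopologicalSpace N] [ChartedSpace (EuclideanSpace ℝ (Fin k)) N]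
    (ι : N → M), IsLeaf D k ι → CompactSpace N

/-- `D` is a parallel distribution with compact leaves. -/
structure IsParallelWithCompactLeaves [IsManifold (𝓡 n) ∞ M]
    [RiemannianBundle (fun x : M => TangentSpace (𝓡 n) x)]
    (D : (x : M) → Submodule ℝ (TangentSpace (𝓡 n) x)) : Prop where
  isDistribution : IsDistribution D
  isParallel : IsParallel D
  allLeavesCompact : AllLeavesCompact D

end FlatManifold

end

/-! Flat charts differ by affine isometries (`IsFlatChart.transition`), and compactness allows a
local inverse of a flat chart to be continued to a developing map `φ` on all of Euclidean space
(`exists_isDevelopingOn_univ`). Such a `φ` is locally injective, and its fibres are the orbits of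
the group Γ of affine isometries `g` with `φ ∘ g = φ` (`IsDevelopingOn.isHomogeneous`).

In a flat chart the Levi-Civita connection is the ordinary derivative, so a parallel distribution
pulls back along `φ` to a constant subspace `W` (`IsDevelopingOn.exists_pullsBackTo`), which is
invariant under the linear parts of Γ. The leaf through `φ 0` is `φ '' W`, and it is compact in its
own topology exactly when a bounded part of `W` already has image `φ '' W`; this is `IsCobounded`
(`AllLeavesCompact.isCobounded`, `IsConnectedIntegralManifold.compactSpace`).

Spans and intersections of distributions pull back to suprema and infima of subspaces, and finite
dimension leaves only finite families. It remains to see that coboundedness passes to sums and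
intersections of invariant subspaces. For a sum, one element of Γ bounds the first component, a
second one bounds the other, and linear parts preserve both subspaces and all norms
(`IsCobounded.sup`). For an intersection, each point is represented by a pair of bounded vectors,
one in each subspace; such pairs form a compact set, near each point of which the first entries lie
in a single translate of the intersection (`IsCobounded.inf`). The empty intersection is where
compactness of the manifold itself enters (`IsDevelopingOn.isCobounded_top`). -/

section

open Filter Topology

set_option linter.unusedSectionVars false

local notation "𝔼" n:max => EuclideanSpace ℝ (Fin n)

noncomputable section

namespace FlatManifold

/-! ### Rigidity of local isometries of Euclidean space -/

section Euclidean

variable {E : Type*} [NormedAddCommGroup E] [InnerProductSpace ℝ E]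

/-- A smooth map whose differentials are linear isometries on a convex open set has constant
derivative there. -/
theorem fderiv_eq_of_inner_fderiv [FiniteDimensional ℝ E] {f : E → E} {s : Set E} (hs : IsOpen s)
    (hc : Convex ℝ s) (hf : ContDiffOn ℝ ∞ f s)
    (hiso : ∀ p ∈ s, ∀ v w, inner ℝ (fderiv ℝ f p v) (fderiv ℝ f p w) = inner ℝ v w)
    {p q : E} (hp : p ∈ s) (hq : q ∈ s) : fderiv ℝ f p = fderiv ℝ f q := by
  have hcd : ∀ x ∈ s, ContDiffAt ℝ ∞ f x := fun x hx => hf.contDiffAt (hs.mem_nhds hx)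
  have hd : ∀ x ∈ s, DifferentiableAt ℝ (fderiv ℝ f) x := fun x hx =>
    ((hcd x hx).fderiv_right (m := 1) (by norm_cast)).differentiableAt (by simp)
  refine hs.is_const_of_fderiv_eq_zero hc.isPreconnected
    (fun x hx => (hd x hx).differentiableWithinAt) (fun x hx => ?_) hp hq
  set T := fderiv ℝ (fderiv ℝ f) x with hT
  have hsymm : ∀ u v, T u v = T v u := fun u v =>
    (hcd x hx).isSymmSndFDerivAt (by simp; norm_cast) u v
  have hanti : ∀ u v w, inner ℝ (T u v) (fderiv ℝ f x w) = - inner ℝ (T u w) (fderiv ℝ f x v) := by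
    intro u v w
    have h1 : HasFDerivAt (fun y => fderiv ℝ f y v) (T.flip v) x := by
      simpa using ((hd x hx).hasFDerivAt.clm_apply (hasFDerivAt_const v x))
    have h2 : HasFDerivAt (fun y => fderiv ℝ f y w) (T.flip w) x := by
      simpa using ((hd x hx).hasFDerivAt.clm_apply (hasFDerivAt_const w x))
    have h3 := h1.inner ℝ h2
    have h4 : (fun y => inner ℝ (fderiv ℝ f y v) (fderiv ℝ f y w)) =ᶠ[𝓝 x]
        fun _ => inner ℝ v w := by
      filter_upwards [hs.mem_nhds hx] with y hy using hiso y hy v w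
    have h5 := h3.unique ((hasFDerivAt_const (inner ℝ v w) x).congr_of_eventuallyEq h4)
    have h6 := congrArg (fun A => A u) h5
    simp [fderivInnerCLM_apply] at h6
    rw [real_inner_comm (fderiv ℝ f x v) (T u w)]
    linarith
  have hinj : Function.Injective (fderiv ℝ f x) := by
    rw [injective_iff_map_eq_zero]
    intro v hv
    have := hiso x hx v v
    rw [hv, inner_zero_left] at this
    exact inner_self_eq_zero.mp this.symm
  have hsurj : Function.Surjective (fderiv ℝ f x) :=
    (fderiv ℝ f x).toLinearMap.injective_iff_surjective.mp hinj
  ext u v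
  -- The trilinear form `⟨T u v, f' w⟩` is symmetric in `u, v` and skew in `v, w`; going around the
  -- three arguments changes its sign, so it vanishes.
  have key : ∀ w, inner ℝ (T u v) (fderiv ℝ f x w) = 0 := by
    intro w
    have e1 := hanti u v w
    have e2 := hanti w u v
    have e3 := hanti v w u
    rw [hsymm w u, hsymm w v] at e2
    rw [hsymm v u] at e3
    linarith
  obtain ⟨w, hw⟩ := hsurj (T u v)
  have := key w
  rw [hw] at this
  simpa using inner_self_eq_zero.mp this

/-- A smooth map whose differentials are linear isometries near a point is, near this point, an
affine isometry. -/
theorem exists_affineIsometryEquiv_eventuallyEq [FiniteDimensional ℝ E] {f : E → E} {s : Set E}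
    (hs : IsOpen s) (hf : ContDiffOn ℝ ∞ f s)
    (hiso : ∀ p ∈ s, ∀ v w, inner ℝ (fderiv ℝ f p v) (fderiv ℝ f p w) = inner ℝ v w)
    {p : E} (hp : p ∈ s) : ∃ g : E ≃ᵃⁱ[ℝ] E, f =ᶠ[𝓝 p] g := by
  obtain ⟨r, hr, hball⟩ := Metric.isOpen_iff.mp hs p hp
  set A := fderiv ℝ f p with hA
  have hpb : p ∈ Metric.ball p r := Metric.mem_ball_self hr
  let L : E →ₗᵢ[ℝ] E := A.toLinearMap.isometryOfInner (hiso p hp)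
  let L' : E ≃ₗᵢ[ℝ] E := L.toLinearIsometryEquiv rfl
  let g : E ≃ᵃⁱ[ℝ] E := ((AffineIsometryEquiv.vaddConst ℝ p).symm.trans
    L'.toAffineIsometryEquiv).trans (AffineIsometryEquiv.vaddConst ℝ (f p))
  have hg : ∀ x, g x = A (x - p) + f p := fun x => rfl
  refine ⟨g, ?_⟩
  have hfd : ∀ x ∈ Metric.ball p r, HasFDerivAt f A x := fun x hx => by
    have h1 : DifferentiableAt ℝ f x :=
      (hf.contDiffAt (hs.mem_nhds (hball hx))).differentiableAt (by simp)
    rw [hA, fderiv_eq_of_inner_fderiv Metric.isOpen_ball (convex_ball p r) (hf.mono hball)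
      (fun q hq => hiso q (hball hq)) hpb hx]
    exact h1.hasFDerivAt
  have hgd : ∀ x, HasFDerivAt g A x := fun x => by
    have : HasFDerivAt (fun x => A (x - p) + f p) A x := by
      simpa using (A.hasFDerivAt.comp x ((hasFDerivAt_id x).sub_const p)).add_const (f p)
    exact this
  have heq : Set.EqOn f g (Metric.ball p r) :=
    Metric.isOpen_ball.eqOn_of_fderiv_eq (convex_ball p r).isPreconnected
      (fun x hx => (hfd x hx).differentiableAt.differentiableWithinAt)
      (fun x _ => (hgd x).differentiableAt.differentiableWithinAt)
      (fun x hx => by rw [(hfd x hx).fderiv, (hgd x).fderiv]) hpb (by simp [hg])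
  exact heq.eventuallyEq_of_mem (Metric.ball_mem_nhds p hr)

theorem affineIsometryEquiv_eq_of_eventuallyEq {f g : E ≃ᵃⁱ[ℝ] E} {p : E} (h : f =ᶠ[𝓝 p] g) :
    f = g := by
  have key : ∀ v, f.linearIsometryEquiv v = g.linearIsometryEquiv v := by
    intro v
    have hc : Tendsto (fun t : ℝ => t • v +ᵥ p) (𝓝 0) (𝓝 p) := by
      have : Continuous (fun t : ℝ => t • v +ᵥ p) := by simp only [vadd_eq_add]; fun_prop
      simpa using this.tendsto 0
    -- A nonzero `t` is needed, so that the scalar can be cancelled from `t • f' v = t • g' v`.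
    have h1 := (hc.eventually h).filter_mono (nhdsWithin_le_nhds (s := {0}ᶜ))
    obtain ⟨t, ht, ht0⟩ := (h1.and self_mem_nhdsWithin).exists
    rw [f.map_vadd, g.map_vadd, h.self_of_nhds] at ht
    have := vadd_right_cancel _ ht
    rw [map_smul, map_smul] at this
    exact smul_right_injective E ht0 this
  ext x
  have e : x = (x - p) +ᵥ p := by simp
  rw [e, f.map_vadd, g.map_vadd, key, h.self_of_nhds]

end Euclidean

/-! ### Coboundedness of sums and intersections of invariant subspaces -/

section Homogeneous

/-- A maximal finite supremum absorbs every further `W j`. The generality of a lattice lets the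
order dual serve for infima. -/
theorem exists_finset_iSup_eq {α J : Type*} [CompleteLattice α] [WellFoundedGT α] (W : J → α) :
    ∃ t : Finset J, ⨆ j, W j = ⨆ j ∈ t, W j := by
  classical
  obtain ⟨_, ⟨t, rfl⟩, ht⟩ := wellFounded_gt.has_min
    (Set.range fun t : Finset J => ⨆ j ∈ t, W j) ⟨_, ∅, rfl⟩
  refine ⟨t, le_antisymm (iSup_le fun j => ?_) (iSup₂_le fun j _ => le_iSup W j)⟩
  have h1 : ⨆ j ∈ t, W j ≤ ⨆ i ∈ insert j t, W i :=
    biSup_mono fun i hi => Finset.mem_insert_of_mem hi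
  have h2 := h1.eq_of_not_lt (ht _ ⟨insert j t, rfl⟩)
  rw [h2]
  exact le_biSup W (Finset.mem_insert_self j t)

variable {E : Type*} [NormedAddCommGroup E] [InnerProductSpace ℝ E]
  {X : Type*}

/-- The image of `W` under `φ` is the image of a bounded part of `W`. -/
def IsCobounded (φ : E → X) (W : Submodule ℝ E) : Prop :=
  ∃ R : ℝ, ∀ w ∈ W, ∃ u ∈ W, ‖u‖ ≤ R ∧ φ u = φ w

/-- `W` is invariant under the linear parts of the affine isometries preserving `φ`. -/
def IsHolonomyInvariant (φ : E → X) (W : Submodule ℝ E) : Prop :=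
  ∀ g : E ≃ᵃⁱ[ℝ] E, (∀ v, φ (g v) = φ v) → ∀ w ∈ W, g.linearIsometryEquiv w ∈ W

theorem IsHolonomyInvariant.iSup {φ : E → X} {J : Type*} {W : J → Submodule ℝ E}
    (h : ∀ j, IsHolonomyInvariant φ (W j)) : IsHolonomyInvariant φ (⨆ j, W j) := by
  intro g hg w hw
  have : (⨆ j, W j) ≤ (⨆ j, W j).comap g.linearIsometryEquiv.toLinearEquiv.toLinearMap :=
    iSup_le fun j x hx => Submodule.mem_iSup_of_mem j (h j g hg x hx)
  exact this hw

theorem IsHolonomyInvariant.iInf {φ : E → X} {J : Type*} {W : J → Submodule ℝ E}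
    (h : ∀ j, IsHolonomyInvariant φ (W j)) : IsHolonomyInvariant φ (⨅ j, W j) := by
  intro g hg w hw
  rw [Submodule.mem_iInf] at hw ⊢
  exact fun j => h j g hg w (hw j)

theorem IsHolonomyInvariant.sup {φ : E → X} {W₁ W₂ : Submodule ℝ E}
    (h₁ : IsHolonomyInvariant φ W₁) (h₂ : IsHolonomyInvariant φ W₂) :
    IsHolonomyInvariant φ (W₁ ⊔ W₂) := by
  rw [sup_eq_iSup]
  exact .iSup fun b => by cases b <;> assumption

theorem IsHolonomyInvariant.inf {φ : E → X} {W₁ W₂ : Submodule ℝ E}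
    (h₁ : IsHolonomyInvariant φ W₁) (h₂ : IsHolonomyInvariant φ W₂) :
    IsHolonomyInvariant φ (W₁ ⊓ W₂) := by
  rw [inf_eq_iInf]
  exact .iInf fun b => by cases b <;> assumption

theorem IsHolonomyInvariant.symm {φ : E → X} {W : Submodule ℝ E} (h : IsHolonomyInvariant φ W)
    {g : E ≃ᵃⁱ[ℝ] E} (hg : ∀ v, φ (g v) = φ v) {w : E} (hw : g.linearIsometryEquiv w ∈ W) :
    w ∈ W := by
  have h1 : ∀ v, φ (g.symm v) = φ v := fun v => by rw [← hg (g.symm v), g.apply_symm_apply]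
  have h2 : g.symm.linearIsometryEquiv (g.linearIsometryEquiv w) = w :=
    g.linearIsometryEquiv.symm_apply_apply w
  exact h2 ▸ h g.symm h1 _ hw

theorem isCobounded_bot (φ : E → X) : IsCobounded φ ⊥ :=
  ⟨0, fun w hw => ⟨w, hw, by simp [(Submodule.mem_bot ℝ).mp hw], rfl⟩⟩

variable [TopologicalSpace X]

/-- A continuous, locally injective map whose fibres are the orbits of a group of affine
isometries. -/
structure IsHomogeneous (φ : E → X) : Prop where
  continuous : Continuous φ
  locallyInjective : ∀ a, ∃ U ∈ 𝓝 a, Set.InjOn φ U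
  exists_isometry : ∀ a b, φ a = φ b → ∃ g : E ≃ᵃⁱ[ℝ] E, (∀ v, φ (g v) = φ v) ∧ g a = b

/-- An isometry `g` carries `w₁` to a bounded `u₁` and turns `w₂` into another vector of `W₂`; a
second one `k` carries that vector to a bounded `u₂` and only rotates `u₁` inside `W₁`. Hence `w₁ +
w₂` is moved to `k' u₁ + u₂`, where `k'` is the linear part of `k`. -/
theorem IsCobounded.sup {φ : E → X} (hφ : IsHomogeneous φ) {W₁ W₂ : Submodule ℝ E}
    (i₁ : IsHolonomyInvariant φ W₁) (i₂ : IsHolonomyInvariant φ W₂)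
    (h₁ : IsCobounded φ W₁) (h₂ : IsCobounded φ W₂) : IsCobounded φ (W₁ ⊔ W₂) := by
  obtain ⟨R₁, h₁⟩ := h₁
  obtain ⟨R₂, h₂⟩ := h₂
  refine ⟨R₂ + R₁, fun w hw => ?_⟩
  obtain ⟨w₁, hw₁, w₂, hw₂, rfl⟩ := Submodule.mem_sup.mp hw
  obtain ⟨u₁, hu₁, hR₁, he₁⟩ := h₁ w₁ hw₁
  obtain ⟨g, hg, hgu⟩ := hφ.exists_isometry _ _ he₁.symm
  have hv₂ := i₂ g hg w₂ hw₂
  obtain ⟨u₂, hu₂, hR₂, he₂⟩ := h₂ _ hv₂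
  obtain ⟨k, hk, hku⟩ := hφ.exists_isometry _ _ he₂.symm
  have e1 : g (w₁ + w₂) = g.linearIsometryEquiv w₂ + u₁ := by
    rw [add_comm, ← vadd_eq_add, g.map_vadd, hgu, vadd_eq_add]
  have e2 : k (g (w₁ + w₂)) = k.linearIsometryEquiv u₁ + u₂ := by
    rw [e1, add_comm, ← vadd_eq_add, k.map_vadd, hku, vadd_eq_add]
  refine ⟨k (g (w₁ + w₂)), ?_, ?_, by rw [hk, hg]⟩
  · rw [e2]
    exact add_mem (Submodule.mem_sup_left (i₁ k hk _ hu₁)) (Submodule.mem_sup_right hu₂)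
  · rw [e2, add_comm R₂]
    refine (norm_add_le _ _).trans (add_le_add ?_ hR₂)
    rwa [LinearIsometryEquiv.norm_map]

theorem IsCobounded.inf [FiniteDimensional ℝ E] [T2Space X] {φ : E → X} (hφ : IsHomogeneous φ)
    {W₁ W₂ : Submodule ℝ E} (i₁ : IsHolonomyInvariant φ W₁) (i₂ : IsHolonomyInvariant φ W₂)
    (h₁ : IsCobounded φ W₁) (h₂ : IsCobounded φ W₂) : IsCobounded φ (W₁ ⊓ W₂) := by
  obtain ⟨R₁, h₁⟩ := h₁
  obtain ⟨R₂, h₂⟩ := h₂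
  have i := i₁.inf i₂
  -- Every `w` in the intersection yields a pair in `A` whose entries have the same image as `w`. A
  -- bound that works locally on `A` becomes global by compactness.
  let A : Set (E × E) := (((W₁ : Set E) ∩ Metric.closedBall 0 R₁) ×ˢ
    ((W₂ : Set E) ∩ Metric.closedBall 0 R₂)) ∩ {z | φ z.1 = φ z.2}
  have hA : IsCompact A := by
    refine IsCompact.inter_right (IsCompact.prod ?_ ?_)
      (isClosed_eq (hφ.continuous.comp continuous_fst) (hφ.continuous.comp continuous_snd))
    · exact (isCompact_closedBall 0 R₁).inter_left W₁.closed_of_finiteDimensional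
    · exact (isCompact_closedBall 0 R₂).inter_left W₂.closed_of_finiteDimensional
  have key : ∃ R : ℝ, ∀ z ∈ A, ∀ w ∈ W₁ ⊓ W₂, φ w = φ z.1 → ∃ u ∈ W₁ ⊓ W₂, ‖u‖ ≤ R ∧ φ u = φ w := by
    refine hA.induction_on (p := fun B => ∃ R : ℝ, ∀ z ∈ B, ∀ w ∈ W₁ ⊓ W₂, φ w = φ z.1 →
      ∃ u ∈ W₁ ⊓ W₂, ‖u‖ ≤ R ∧ φ u = φ w) ⟨0, by simp⟩ ?_ ?_ ?_
    · rintro s t hst ⟨R, hR⟩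
      exact ⟨R, fun z hz => hR z (hst hz)⟩
    · rintro s t ⟨R, hR⟩ ⟨R', hR'⟩
      refine ⟨max R R', ?_⟩
      rintro z (hz | hz) w hw e
      · obtain ⟨u, hu, hb, hh⟩ := hR z hz w hw e
        exact ⟨u, hu, hb.trans (le_max_left _ _), hh⟩
      · obtain ⟨u, hu, hb, hh⟩ := hR' z hz w hw e
        exact ⟨u, hu, hb.trans (le_max_right _ _), hh⟩
    · rintro ⟨a₁, a₂⟩ ⟨⟨⟨ha₁, -⟩, ⟨ha₂, -⟩⟩, hae : φ a₁ = φ a₂⟩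
      obtain ⟨g, hg, hga⟩ := hφ.exists_isometry _ _ hae
      obtain ⟨U, hU, hinj⟩ := hφ.locallyInjective a₂
      have hn : ∀ᶠ z : E × E in 𝓝 (a₁, a₂), z.1 ∈ Metric.ball a₁ 1 ∧ g z.1 ∈ U ∧ z.2 ∈ U := by
        refine (continuousAt_fst.eventually_mem (Metric.ball_mem_nhds a₁ one_pos)).and (.and ?_ ?_)
        · have : ContinuousAt (fun z : E × E => g z.1) (a₁, a₂) :=
            (g.continuous.comp continuous_fst).continuousAt
          exact this.eventually_mem (by simpa [hga] using hU)
        · exact continuousAt_snd.eventually_mem hU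
      -- Local injectivity near `a₂` forces `g z.1 = z.2`. So the linear part of `g` takes `z.1 -
      -- a₁` to `z.2 - a₂` in `W₂`, and by invariance `z.1 - a₁` itself lies in `W₂`.
      have hdiff : ∀ z ∈ A, (z.1 ∈ Metric.ball a₁ 1 ∧ g z.1 ∈ U ∧ z.2 ∈ U) →
          z.1 - a₁ ∈ W₁ ⊓ W₂ := by
        rintro ⟨z₁, z₂⟩ ⟨⟨⟨hz₁, -⟩, ⟨hz₂, -⟩⟩, hze : φ z₁ = φ z₂⟩ ⟨-, hgU, hzU⟩
        refine ⟨sub_mem hz₁ ha₁, i₂.symm hg ?_⟩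
        have e : g z₁ = z₂ := hinj hgU hzU (by rw [hg, hze])
        have : g.linearIsometryEquiv (z₁ - a₁) = z₂ - a₂ := by
          rw [← e, ← hga, ← vsub_eq_sub, ← vsub_eq_sub, g.map_vsub]
        rw [this]
        exact sub_mem hz₂ ha₂
      refine ⟨{z | z.1 ∈ Metric.ball a₁ 1 ∧ g z.1 ∈ U ∧ z.2 ∈ U} ∩ A,
        inter_mem (mem_nhdsWithin_of_mem_nhds hn) self_mem_nhdsWithin, ?_⟩
      -- One vector `w` of the intersection, fixed for the whole neighbourhood, gives the bound: an
      -- isometry taking `z.1` to `w` takes every other first entry to within distance 2 of `w`,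
      -- still inside the intersection. Without such a `w` the claim is vacuous here.
      by_cases hex : ∃ z ∈ A, (z.1 ∈ Metric.ball a₁ 1 ∧ g z.1 ∈ U ∧ z.2 ∈ U) ∧
          ∃ w ∈ W₁ ⊓ W₂, φ w = φ z.1
      · obtain ⟨z, hz, hzU, w, hw, hwe⟩ := hex
        refine ⟨2 + ‖w‖, ?_⟩
        rintro y ⟨hyU, hy⟩ w' - hwe'
        obtain ⟨k, hk, hkz⟩ := hφ.exists_isometry _ _ hwe.symm
        have e : k y.1 = k.linearIsometryEquiv (y.1 - z.1) + w := by
          rw [← hkz, ← vadd_eq_add, ← k.map_vadd]; simp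
        refine ⟨k y.1, ?_, ?_, by rw [hk, hwe']⟩
        · rw [e]
          refine add_mem (i k hk _ ?_) hw
          have := sub_mem (hdiff y hy hyU) (hdiff z hz hzU)
          simpa using this
        · rw [e]
          refine (norm_add_le _ _).trans (add_le_add_left ?_ _)
          rw [LinearIsometryEquiv.norm_map, ← dist_eq_norm]
          have h1 := Metric.mem_ball.mp hyU.1
          have h2 := Metric.mem_ball.mp hzU.1
          have := dist_triangle_right y.1 z.1 a₁
          linarith
      · refine ⟨0, ?_⟩
        rintro y ⟨hyU, hy⟩ w hw hwe
        exact absurd ⟨y, hy, hyU, w, hw, hwe⟩ hex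
  obtain ⟨R, hR⟩ := key
  refine ⟨R, fun w hw => ?_⟩
  obtain ⟨u₁, hu₁, hn₁, he₁⟩ := h₁ w hw.1
  obtain ⟨u₂, hu₂, hn₂, he₂⟩ := h₂ w hw.2
  exact hR (u₁, u₂) ⟨⟨⟨hu₁, by simpa using hn₁⟩, ⟨hu₂, by simpa using hn₂⟩⟩, he₁.trans he₂.symm⟩
    w hw he₁.symm

theorem IsCobounded.iSup [FiniteDimensional ℝ E] {φ : E → X} (hφ : IsHomogeneous φ) {J : Type*}
    {W : J → Submodule ℝ E} (i : ∀ j, IsHolonomyInvariant φ (W j))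
    (h : ∀ j, IsCobounded φ (W j)) : IsCobounded φ (⨆ j, W j) := by
  classical
  obtain ⟨t, ht⟩ : ∃ t : Finset J, ⨆ j, W j = ⨆ j ∈ t, W j :=
    exists_finset_iSup_eq W
  rw [ht]
  have : ∀ s : Finset J, IsHolonomyInvariant φ (⨆ j ∈ s, W j) ∧ IsCobounded φ (⨆ j ∈ s, W j) := by
    intro s
    induction s using Finset.induction_on with
    | empty => simpa using ⟨fun g _ w hw => by simp_all, isCobounded_bot φ⟩
    | insert a s _ ih =>
      rw [Finset.iSup_insert]
      exact ⟨(i a).sup ih.1, (h a).sup hφ (i a) ih.1 ih.2⟩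
  exact (this t).2

/-- The infimum of a finite subfamily is reached by induction starting from `⊤`, hence the
hypothesis on `⊤`. -/
theorem IsCobounded.iInf [FiniteDimensional ℝ E] [T2Space X] {φ : E → X} (hφ : IsHomogeneous φ)
    (htop : IsCobounded φ ⊤) {J : Type*} {W : J → Submodule ℝ E}
    (i : ∀ j, IsHolonomyInvariant φ (W j)) (h : ∀ j, IsCobounded φ (W j)) :
    IsCobounded φ (⨅ j, W j) := by
  classical
  obtain ⟨t, ht⟩ : ∃ t : Finset J, ⨅ j, W j = ⨅ j ∈ t, W j :=
    exists_finset_iSup_eq (α := (Submodule ℝ E)ᵒᵈ) W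
  rw [ht]
  have : ∀ s : Finset J, IsHolonomyInvariant φ (⨅ j ∈ s, W j) ∧ IsCobounded φ (⨅ j ∈ s, W j) := by
    intro s
    induction s using Finset.induction_on with
    | empty => simpa using ⟨fun g _ w _ => Submodule.mem_top, htop⟩
    | insert a s _ ih =>
      rw [Finset.iInf_insert]
      exact ⟨(i a).inf ih.1, (h a).inf hφ (i a) ih.1 ih.2⟩
  exact (this t).2

end Homogeneous

/-! ### Flat charts and the uniqueness of developing maps -/

section FlatCharts

variable {n : ℕ} {M : Type u} [TopologicalSpace M] [ChartedSpace (𝔼 n) M]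
  [IsManifold (𝓡 n) ∞ M] [RiemannianBundle (fun x : M => TangentSpace (𝓡 n) x)]

/-- A smooth chart whose differentials are linear isometries. -/
structure IsFlatChart (e : OpenPartialHomeomorph M (𝔼 n)) : Prop where
  mem_maximalAtlas : e ∈ IsManifold.maximalAtlas (𝓡 n) ∞ M
  inner_mfderiv : ∀ y ∈ e.source, ∀ v w : TangentSpace (𝓡 n) y,
    inner ℝ (mfderiv (𝓡 n) (𝓡 n) e y v : 𝔼 n) (mfderiv (𝓡 n) (𝓡 n) e y w : 𝔼 n) = inner ℝ v w

variable {e e' : OpenPartialHomeomorph M (𝔼 n)}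

theorem IsFlatChart.contMDiffAt (he : IsFlatChart e) {y : M} (hy : y ∈ e.source) :
    ContMDiffAt (𝓡 n) (𝓡 n) ∞ e y :=
  contMDiffAt_of_mem_maximalAtlas he.mem_maximalAtlas hy

theorem IsFlatChart.contMDiffAt_symm (he : IsFlatChart e) {p : 𝔼 n} (hp : p ∈ e.target) :
    ContMDiffAt (𝓡 n) (𝓡 n) ∞ e.symm p :=
  contMDiffAt_symm_of_mem_maximalAtlas he.mem_maximalAtlas hp

theorem IsFlatChart.mdifferentiable (he : IsFlatChart e) : e.MDifferentiable (𝓡 n) (𝓡 n) :=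
  ⟨fun _ hy => ((he.contMDiffAt hy).mdifferentiableAt (by simp)).mdifferentiableWithinAt,
    fun _ hp => ((he.contMDiffAt_symm hp).mdifferentiableAt (by simp)).mdifferentiableWithinAt⟩

theorem IsFlatChart.mfderiv_mfderiv_symm (he : IsFlatChart e) {p : 𝔼 n} (hp : p ∈ e.target)
    (u : 𝔼 n) : mfderiv (𝓡 n) (𝓡 n) e (e.symm p) (mfderiv (𝓡 n) (𝓡 n) e.symm p u) = u :=
  DFunLike.congr_fun (he.mdifferentiable.comp_symm_deriv hp) u

theorem IsFlatChart.inner_mfderiv_symm (he : IsFlatChart e) {p : 𝔼 n} (hp : p ∈ e.target)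
    (u v : 𝔼 n) : inner ℝ (mfderiv (𝓡 n) (𝓡 n) e.symm p u : TangentSpace (𝓡 n) (e.symm p))
      (mfderiv (𝓡 n) (𝓡 n) e.symm p v) = inner ℝ u v := by
  rw [← he.inner_mfderiv _ (e.map_target hp)]
  rw [he.mfderiv_mfderiv_symm hp, he.mfderiv_mfderiv_symm hp]
  rfl

theorem IsFlatChart.transition (he : IsFlatChart e) (he' : IsFlatChart e') {y : M}
    (hy : y ∈ e.source) (hy' : y ∈ e'.source) :
    ∃ g : 𝔼 n ≃ᵃⁱ[ℝ] 𝔼 n, ∀ᶠ z in 𝓝 y, e' z = g (e z) := by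
  let s : Set (𝔼 n) := e.target ∩ e.symm ⁻¹' e'.source
  have hs : IsOpen s := e.symm.isOpen_inter_preimage e'.open_source
  have hcm : ∀ p ∈ s, ContMDiffAt (𝓡 n) (𝓡 n) ∞ (e' ∘ e.symm) p := fun p hp =>
    (he'.contMDiffAt hp.2).comp p (he.contMDiffAt_symm hp.1)
  have hf : ContDiffOn ℝ ∞ (e' ∘ e.symm) s := fun p hp =>
    (hcm p hp).contDiffAt.contDiffWithinAt
  have hys : e y ∈ s := ⟨e.map_source hy, by simpa [e.left_inv hy] using hy'⟩
  obtain ⟨g, hg⟩ := exists_affineIsometryEquiv_eventuallyEq hs hf (fun p hp v w => by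
    have h1 : fderiv ℝ (e' ∘ e.symm) p = (mfderiv (𝓡 n) (𝓡 n) e' (e.symm p)).comp
        (mfderiv (𝓡 n) (𝓡 n) e.symm p) := by
      rw [← mfderiv_eq_fderiv]
      exact mfderiv_comp p ((he'.contMDiffAt hp.2).mdifferentiableAt (by simp))
        ((he.contMDiffAt_symm hp.1).mdifferentiableAt (by simp))
    rw [h1]
    exact (he'.inner_mfderiv _ hp.2 _ _).trans (he.inner_mfderiv_symm hp.1 v w)) hys
  refine ⟨g, ?_⟩
  have h2 := (e.continuousAt hy).eventually hg
  filter_upwards [h2, e.open_source.mem_nhds hy] with z hz hze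
  rw [← hz]
  simp [e.left_inv hze]

section

variable {E : Type*} [NormedAddCommGroup E] [NormedSpace ℝ E] (g : E ≃ᵃⁱ[ℝ] E)

theorem isometry_apply_eq (p x : E) : g x = g.linearIsometryEquiv (x - p) + g p := by
  rw [← vadd_eq_add, ← vsub_eq_sub, ← g.map_vadd, vsub_vadd]

theorem contDiff_isometry {m : WithTop ℕ∞} : ContDiff ℝ m g := by
  rw [funext (isometry_apply_eq g 0)]
  exact (g.linearIsometryEquiv.toContinuousLinearEquiv.contDiff.comp
    (contDiff_id.sub contDiff_const)).add contDiff_const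

theorem hasFDerivAt_isometry (p : E) :
    HasFDerivAt g (g.linearIsometryEquiv.toContinuousLinearEquiv : E →L[ℝ] E) p := by
  rw [funext (isometry_apply_eq g p)]
  simpa using (((g.linearIsometryEquiv.toContinuousLinearEquiv : E →L[ℝ] E).hasFDerivAt.comp p
    ((hasFDerivAt_id p).sub_const p)).add_const (g p))

end

theorem IsFlatChart.trans_isometry (he : IsFlatChart e) (g : 𝔼 n ≃ᵃⁱ[ℝ] 𝔼 n) :
    IsFlatChart (e.transHomeomorph g.toHomeomorph) := by
  have hg : ContMDiff (𝓡 n) (𝓡 n) ∞ g := (contDiff_isometry g).contMDiff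
  have hg' : ContMDiff (𝓡 n) (𝓡 n) ∞ g.symm := (contDiff_isometry g.symm).contMDiff
  refine ⟨?_, fun y hy v w => ?_⟩
  · refine OpenPartialHomeomorph.mem_maximalAtlas_of_contMDiffOn (I := 𝓡 n) (n := ∞) _ ?_ ?_
    · intro y hy
      exact (hg.contMDiffAt.comp y (he.contMDiffAt hy)).contMDiffWithinAt
    · intro p hp
      exact ((he.contMDiffAt_symm hp).comp p hg'.contMDiffAt).contMDiffWithinAt
  · have h1 : mfderiv (𝓡 n) (𝓡 n) (e.transHomeomorph g.toHomeomorph) y =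
        (g.linearIsometryEquiv.toContinuousLinearEquiv : 𝔼 n →L[ℝ] 𝔼 n).comp
          (mfderiv (𝓡 n) (𝓡 n) e y) :=
      ((hasFDerivAt_isometry g (e y)).hasMFDerivAt.comp y
        ((he.contMDiffAt hy).mdifferentiableAt (by simp)).hasMFDerivAt).mfderiv
    rw [h1]
    exact (g.linearIsometryEquiv.inner_map_map _ _).trans (he.inner_mfderiv y hy v w)

/-- `φ` is a developing map on `U`: it is locally the inverse of a flat chart. -/
def IsDevelopingOn (φ : 𝔼 n → M) (U : Set (𝔼 n)) : Prop :=
  ∀ v ∈ U, ∃ e : OpenPartialHomeomorph M (𝔼 n), IsFlatChart e ∧ v ∈ e.target ∧ φ =ᶠ[𝓝 v] e.symm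

variable {φ ψ : 𝔼 n → M} {U V : Set (𝔼 n)}

theorem IsDevelopingOn.mono (h : IsDevelopingOn φ U) (hV : V ⊆ U) : IsDevelopingOn φ V :=
  fun v hv => h v (hV hv)

theorem IsFlatChart.isDevelopingOn_symm (he : IsFlatChart e) : IsDevelopingOn e.symm e.target :=
  fun _ hv => ⟨e, he, hv, .rfl⟩

theorem IsDevelopingOn.comp_isometry (h : IsDevelopingOn φ U) (g : 𝔼 n ≃ᵃⁱ[ℝ] 𝔼 n) :
    IsDevelopingOn (φ ∘ g) (g ⁻¹' U) := by
  intro v hv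
  obtain ⟨e, he, hve, heq⟩ := h (g v) hv
  exact ⟨e.transHomeomorph g.symm.toHomeomorph, he.trans_isometry g.symm, hve,
    g.continuous.continuousAt.eventually heq⟩

theorem IsDevelopingOn.continuousAt (h : IsDevelopingOn φ U) {v : 𝔼 n} (hv : v ∈ U) :
    ContinuousAt φ v := by
  obtain ⟨e, -, hve, heq⟩ := h v hv
  exact (e.continuousAt_symm hve).congr heq.symm

/-- Two developing maps that agree at a point differ near it by an affine isometry. -/
theorem IsDevelopingOn.exists_isometry_eventuallyEq (hφ : IsDevelopingOn φ U)
    (hψ : IsDevelopingOn ψ V) {a b : 𝔼 n} (ha : a ∈ U) (hb : b ∈ V) (h : φ a = ψ b) :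
    ∃ g : 𝔼 n ≃ᵃⁱ[ℝ] 𝔼 n, g a = b ∧ φ =ᶠ[𝓝 a] ψ ∘ g := by
  obtain ⟨e, he, hae, hφe⟩ := hφ a ha
  obtain ⟨e', he', hbe, hψe⟩ := hψ b hb
  have h1 : e.symm a = e'.symm b := by rw [← hφe.self_of_nhds, ← hψe.self_of_nhds, h]
  obtain ⟨g, hg⟩ := he.transition he' (e.map_target hae) (h1 ▸ e'.map_target hbe)
  have hgab : g a = b := by
    have := hg.self_of_nhds
    rw [e.right_inv hae, h1, e'.right_inv hbe] at this
    exact this.symm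
  have h2 := (e.continuousAt_symm hae).eventually hg
  have h3 : ∀ᶠ p in 𝓝 a, e.symm p ∈ e'.source :=
    (e.continuousAt_symm hae).eventually_mem (e'.open_source.mem_nhds (h1 ▸ e'.map_target hbe))
  have h4 : ∀ᶠ p in 𝓝 a, ψ (g p) = e'.symm (g p) :=
    g.continuous.continuousAt.eventually (hgab ▸ hψe)
  refine ⟨g, hgab, ?_⟩
  filter_upwards [h2, h3, h4, hφe, e.open_target.mem_nhds hae] with p h2 h3 h4 h5 h6
  rw [Function.comp_apply, h4, h5, ← e'.left_inv h3, h2, e.right_inv h6]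

theorem IsDevelopingOn.exists_injOn (hφ : IsDevelopingOn φ U) {a : 𝔼 n} (ha : a ∈ U) :
    ∃ W ∈ 𝓝 a, Set.InjOn φ W := by
  obtain ⟨e, he, hae, hφe⟩ := hφ a ha
  refine ⟨_, inter_mem hφe (e.open_target.mem_nhds hae), ?_⟩
  rintro p ⟨hp, hpe⟩ q ⟨hq, hqe⟩ hpq
  rw [hp, hq] at hpq
  exact e.symm.injOn hpe hqe hpq

/-- The set where the germs agree is open. At a limit point `v` in `U` the values agree, so `φ = ψ ∘
g` near `v` for an isometry `g` fixing `v`; at a nearby point with equal germs, injectivity of `ψ`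
makes `g` the identity, so the germs agree at `v` too. -/
theorem IsDevelopingOn.eqOn [T2Space M] (hφ : IsDevelopingOn φ U) (hψ : IsDevelopingOn ψ U)
    (hU : IsPreconnected U) {a : 𝔼 n} (ha : a ∈ U) (h : φ =ᶠ[𝓝 a] ψ) :
    Set.EqOn φ ψ U := by
  suffices U ⊆ {v | φ =ᶠ[𝓝 v] ψ} from fun v hv => (this hv).self_of_nhds
  refine hU.subset_of_closure_inter_subset ?_ ⟨a, ha, h⟩ ?_
  · exact isOpen_iff_mem_nhds.mpr fun v hv => eventually_eventuallyEq_nhds.mpr hv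
  · rintro v ⟨hvc, hvU⟩
    have hev : φ v = ψ v := by
      by_contra hne
      have := ((hφ.continuousAt hvU).ne_iff_eventually_ne (hψ.continuousAt hvU)).mp hne
      obtain ⟨w, hw, hw'⟩ := mem_closure_iff_nhds.mp hvc _ this
      exact hw hw'.self_of_nhds
    obtain ⟨g, hgv, hg⟩ := hφ.exists_isometry_eventuallyEq hψ hvU hvU hev
    obtain ⟨W, hW, hinj⟩ := hψ.exists_injOn hvU
    have hgW : ∀ᶠ p in 𝓝 v, g p ∈ W := g.continuous.continuousAt.eventually_mem (by rwa [hgv])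
    have hall := (eventually_eventually_nhds.mpr (hg.and (hgW.and hW)))
    obtain ⟨w, hw, hw'⟩ := mem_closure_iff_nhds.mp hvc _ hall
    have : g = AffineIsometryEquiv.refl ℝ _ := by
      apply affineIsometryEquiv_eq_of_eventuallyEq (p := w)
      have hw1 : ∀ᶠ y in 𝓝 w, φ y = (ψ ∘ g) y ∧ g y ∈ W ∧ y ∈ W := hw
      have hw2 : ∀ᶠ y in 𝓝 w, φ y = ψ y := hw'
      filter_upwards [hw1, hw2] with p h1 h2
      exact hinj h1.2.1 h1.2.2 (h1.1.symm.trans h2)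
    rw [this] at hg
    exact hg

/-- Developing maps on the whole space are determined, up to an affine isometry, by one value. -/
theorem IsDevelopingOn.exists_isometry [T2Space M] (hφ : IsDevelopingOn φ Set.univ)
    (hψ : IsDevelopingOn ψ Set.univ) {a b : 𝔼 n} (h : φ a = ψ b) :
    ∃ g : 𝔼 n ≃ᵃⁱ[ℝ] 𝔼 n, (∀ v, ψ (g v) = φ v) ∧ g a = b := by
  obtain ⟨g, hg, hφg⟩ := hφ.exists_isometry_eventuallyEq hψ (Set.mem_univ a) (Set.mem_univ b) h
  have := hφ.eqOn (hψ.comp_isometry g) isPreconnected_univ (Set.mem_univ a) hφg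
  exact ⟨g, fun v => (this (Set.mem_univ v)).symm, hg⟩

theorem IsDevelopingOn.isHomogeneous [T2Space M] (hφ : IsDevelopingOn φ Set.univ) :
    IsHomogeneous φ where
  continuous := continuous_iff_continuousAt.mpr fun v => hφ.continuousAt (Set.mem_univ v)
  locallyInjective _ := hφ.exists_injOn (Set.mem_univ _)
  exists_isometry _ _ h := hφ.exists_isometry hφ h

end FlatCharts

/-! ### Continuation of developing maps to the whole Euclidean space -/

section Developing

variable {n : ℕ} {M : Type u} [TopologicalSpace M] [ChartedSpace (𝔼 n) M]
  [IsManifold (𝓡 n) ∞ M] [RiemannianBundle (fun x : M => TangentSpace (𝓡 n) x)]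
  {φ ψ : 𝔼 n → M} {U V : Set (𝔼 n)}

theorem IsDevelopingOn.congr (h : IsDevelopingOn φ U) (hψ : ∀ v ∈ U, ψ =ᶠ[𝓝 v] φ) :
    IsDevelopingOn ψ U := by
  intro v hv
  obtain ⟨e, he, hve, heq⟩ := h v hv
  exact ⟨e, he, hve, (hψ v hv).trans heq⟩

theorem IsDevelopingOn.isOpenMap (h : IsDevelopingOn φ Set.univ) : IsOpenMap φ := by
  refine isOpenMap_iff_nhds_le.mpr fun v => ?_
  obtain ⟨e, -, hve, heq⟩ := h v (Set.mem_univ v)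
  rw [map_congr heq, heq.self_of_nhds]
  exact (e.symm.map_nhds_eq hve).ge

/-- Developing maps on open sets that agree on the overlaps can be glued. -/
theorem exists_isDevelopingOn_iUnion [Nonempty M] {ι : Type*} (ψ : ι → 𝔼 n → M)
    (V : ι → Set (𝔼 n)) (hV : ∀ i, IsOpen (V i)) (hψ : ∀ i, IsDevelopingOn (ψ i) (V i))
    (hag : ∀ i j, ∀ v ∈ V i, v ∈ V j → ψ i v = ψ j v) :
    ∃ φ : 𝔼 n → M, IsDevelopingOn φ (⋃ i, V i) ∧ ∀ i, Set.EqOn φ (ψ i) (V i) := by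
  classical
  let φ : 𝔼 n → M := fun v =>
    if h : ∃ i, v ∈ V i then ψ h.choose v else Classical.arbitrary M
  have hφ : ∀ i, Set.EqOn φ (ψ i) (V i) := fun i v hv => by
    have h : ∃ i, v ∈ V i := ⟨i, hv⟩
    simp only [φ, dif_pos h]
    exact hag _ _ v h.choose_spec hv
  refine ⟨φ, fun v hv => ?_, hφ⟩
  obtain ⟨i, hi⟩ := Set.mem_iUnion.mp hv
  exact (hψ i).congr (fun w hw => (hφ i).eventuallyEq_of_mem ((hV i).mem_nhds hw)) v hi

theorem exists_uniform_isDevelopingOn [CompactSpace M] (hflat : IsFlat n M) :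
    ∃ ε > 0, ∀ y : M, ∃ ψ : 𝔼 n → M, IsDevelopingOn ψ (Metric.ball 0 ε) ∧ ψ 0 = y := by
  suffices h : ∃ ε > 0, ∀ y ∈ (Set.univ : Set M), ∃ ψ : 𝔼 n → M,
      IsDevelopingOn ψ (Metric.ball 0 ε) ∧ ψ 0 = y by simpa using h
  refine isCompact_univ.induction_on (p := fun S : Set M => ∃ ε > 0, ∀ y ∈ S, ∃ ψ : 𝔼 n → M,
      IsDevelopingOn ψ (Metric.ball 0 ε) ∧ ψ 0 = y) ⟨1, one_pos, by simp⟩ ?_ ?_ ?_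
  · rintro s t hst ⟨ε, hε, h⟩
    exact ⟨ε, hε, fun y hy => h y (hst hy)⟩
  · rintro s t ⟨ε, hε, h⟩ ⟨ε', hε', h'⟩
    refine ⟨min ε ε', lt_min hε hε', ?_⟩
    rintro y (hy | hy)
    · obtain ⟨ψ, hψ, hy⟩ := h y hy
      exact ⟨ψ, hψ.mono (Metric.ball_subset_ball (min_le_left _ _)), hy⟩
    · obtain ⟨ψ, hψ, hy⟩ := h' y hy
      exact ⟨ψ, hψ.mono (Metric.ball_subset_ball (min_le_right _ _)), hy⟩
  · intro x _
    obtain ⟨e, hem, hx, hei⟩ := hflat x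
    have he : IsFlatChart e := ⟨hem, hei⟩
    obtain ⟨r, hr, hball⟩ := Metric.isOpen_iff.mp e.open_target _ (e.map_source hx)
    -- For `e y` within `r / 2` of `e x`, the ball of radius `r / 2` about `e y` stays in the target
    -- of `e`, so one radius serves all these `y`.
    refine ⟨e.source ∩ e ⁻¹' Metric.ball (e x) (r / 2), mem_nhdsWithin_of_mem_nhds
      (inter_mem (e.open_source.mem_nhds hx)
        ((e.continuousAt hx).preimage_mem_nhds (Metric.ball_mem_nhds _ (half_pos hr)))),
      r / 2, half_pos hr, ?_⟩
    rintro y ⟨hy, hye⟩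
    let g := AffineIsometryEquiv.constVAdd ℝ (𝔼 n) (e y)
    refine ⟨e.symm ∘ g, (he.isDevelopingOn_symm.comp_isometry g).mono fun v hv => hball ?_, ?_⟩
    · have h1 : dist (g v) (e y) < r / 2 := by simpa [g, dist_eq_norm] using hv
      have h2 := dist_triangle (g v) (e y) (e x)
      have h3 : dist (e y) (e x) < r / 2 := hye
      exact Metric.mem_ball.mpr (by linarith)
    · simp [g, e.left_inv hy]

variable [T2Space M] {ε : ℝ}
  (hM : ∀ y : M, ∃ ψ : 𝔼 n → M, IsDevelopingOn ψ (Metric.ball 0 ε) ∧ ψ 0 = y)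

include hM in
theorem IsDevelopingOn.exists_ball (h : IsDevelopingOn φ U) {c : 𝔼 n} (hc : c ∈ U) (hε : 0 < ε) :
    ∃ ψ : 𝔼 n → M, IsDevelopingOn ψ (Metric.ball c ε) ∧ ψ =ᶠ[𝓝 c] φ := by
  obtain ⟨ψ, hψ, hψ0⟩ := hM (φ c)
  obtain ⟨g, hg, heq⟩ := h.exists_isometry_eventuallyEq hψ hc (Metric.mem_ball_self hε) hψ0.symm
  refine ⟨ψ ∘ g, (hψ.comp_isometry g).mono fun v hv => ?_, heq.symm⟩
  rw [Set.mem_preimage, ← hg, Metric.mem_ball, g.dist_map]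
  exact hv

-- Each centre `c` in the ball carries a developing map on `ball c ε` with the germ of `φ` at `c`.
-- If two of these balls meet, the midpoint of the centres lies in both and, by convexity, in the
-- original ball, where both maps equal `φ`; uniqueness on the convex overlap then permits gluing.
include hM in
theorem IsDevelopingOn.exists_extension {R : ℝ} (h : IsDevelopingOn φ (Metric.ball 0 R))
    (hR : 0 < R) (hε : 0 < ε) : ∃ ψ : 𝔼 n → M, IsDevelopingOn ψ (Metric.ball 0 (R + ε)) ∧
      Set.EqOn ψ φ (Metric.ball 0 R) := by
  have : Nonempty M := ⟨φ 0⟩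
  choose ψ hψ hψφ using fun c : Metric.ball (0 : 𝔼 n) R => h.exists_ball hM c.2 hε
  have h1 : ∀ c : Metric.ball (0 : 𝔼 n) R, ∀ v ∈ Metric.ball (c : 𝔼 n) ε, v ∈ Metric.ball 0 R →
      ψ c v = φ v := fun c v hv hv' =>
    ((hψ c).mono Set.inter_subset_left).eqOn (h.mono Set.inter_subset_right)
      ((convex_ball _ _).inter (convex_ball _ _)).isPreconnected ⟨Metric.mem_ball_self hε, c.2⟩ (hψφ c)
      ⟨hv, hv'⟩
  obtain ⟨χ, hχ, hχψ⟩ := exists_isDevelopingOn_iUnion ψ (fun c => Metric.ball (c : 𝔼 n) ε)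
    (fun c => Metric.isOpen_ball) hψ (by
      intro c d v hvc hvd
      have hcd : dist (c : 𝔼 n) d < 2 * ε := by
        have := dist_triangle_left (c : 𝔼 n) d v
        rw [Metric.mem_ball] at hvc hvd
        linarith
      let m := midpoint ℝ (c : 𝔼 n) d
      have hmc : m ∈ Metric.ball (c : 𝔼 n) ε := by
        rw [Metric.mem_ball, dist_midpoint_left]
        norm_num
        linarith
      have hmd : m ∈ Metric.ball (d : 𝔼 n) ε := by
        rw [Metric.mem_ball, dist_midpoint_right]
        norm_num
        linarith
      have hmR : m ∈ Metric.ball (0 : 𝔼 n) R := (convex_ball _ _).midpoint_mem c.2 d.2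
      refine ((hψ c).mono Set.inter_subset_left).eqOn ((hψ d).mono Set.inter_subset_right)
        ((convex_ball _ _).inter (convex_ball _ _)).isPreconnected ⟨hmc, hmd⟩ ?_ ⟨hvc, hvd⟩
      filter_upwards [Metric.isOpen_ball.mem_nhds hmc, Metric.isOpen_ball.mem_nhds hmd,
        Metric.isOpen_ball.mem_nhds hmR] with w hc hd hR
      rw [h1 c w hc hR, h1 d w hd hR])
  refine ⟨χ, hχ.mono fun v hv => ?_, fun v hv => ?_⟩
  · rw [mem_ball_zero_iff] at hv
    have hp : 0 < R + ε := by linarith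
    -- Shrinking `v` by the factor `R / (R + ε)` gives a centre in the small ball at distance `ε /
    -- (R + ε) * ‖v‖ < ε` from `v`.
    have hc : (R / (R + ε)) • v ∈ Metric.ball (0 : 𝔼 n) R := by
      rw [mem_ball_zero_iff, norm_smul, Real.norm_of_nonneg (by positivity), div_mul_eq_mul_div,
        div_lt_iff₀ hp]
      exact mul_lt_mul_of_pos_left hv hR
    refine Set.mem_iUnion.mpr ⟨⟨_, hc⟩, ?_⟩
    have e1 : v - (R / (R + ε)) • v = (ε / (R + ε)) • v := by
      have : ε / (R + ε) = 1 - R / (R + ε) := by field_simp; ring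
      rw [this, sub_smul, one_smul]
    rw [mem_ball_iff_norm, e1, norm_smul, Real.norm_of_nonneg (by positivity), div_mul_eq_mul_div,
      div_lt_iff₀ hp]
    exact mul_lt_mul_of_pos_left hv hε
  · rw [hχψ ⟨v, hv⟩ (Metric.mem_ball_self hε)]
    exact h1 _ v (Metric.mem_ball_self hε) hv

/-- Every point of a compact flat manifold is the value at the origin of a developing map on the
whole Euclidean space. -/
theorem exists_isDevelopingOn_univ [CompactSpace M] (hflat : IsFlat n M) (x : M) :
    ∃ φ : 𝔼 n → M, IsDevelopingOn φ Set.univ ∧ φ 0 = x := by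
  have : Nonempty M := ⟨x⟩
  obtain ⟨ε, hε, hM⟩ := exists_uniform_isDevelopingOn hflat
  obtain ⟨φ₀, hφ₀, hx⟩ := hM x
  have h0 : ∀ k : ℕ, (0 : 𝔼 n) ∈ Metric.ball 0 (ε * (k + 1)) := fun k =>
    Metric.mem_ball_self (by positivity)
  -- Prescribing the germ at the origin makes the maps for different `k` agree on common balls, even
  -- though they are chosen independently.
  have key : ∀ k : ℕ, ∃ φ : 𝔼 n → M, IsDevelopingOn φ (Metric.ball 0 (ε * (k + 1))) ∧
      φ =ᶠ[𝓝 0] φ₀ := by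
    intro k
    induction k with
    | zero => exact ⟨φ₀, by simpa using hφ₀, .rfl⟩
    | succ k ih =>
      obtain ⟨φ, hφ, hφ0⟩ := ih
      obtain ⟨ψ, hψ, hψφ⟩ := hφ.exists_extension hM (by positivity) hε
      refine ⟨ψ, by convert hψ using 2; push_cast; ring, ?_⟩
      exact (hψφ.eventuallyEq_of_mem (Metric.isOpen_ball.mem_nhds (h0 k))).trans hφ0
  choose φ hφ hφ0 using key
  obtain ⟨χ, hχ, hχφ⟩ := exists_isDevelopingOn_iUnion φ (fun k : ℕ => Metric.ball 0 (ε * (k + 1)))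
    (fun k => Metric.isOpen_ball) hφ (fun i j v hi hj =>
      ((hφ i).mono Set.inter_subset_left).eqOn ((hφ j).mono Set.inter_subset_right)
        ((convex_ball _ _).inter (convex_ball _ _)).isPreconnected ⟨h0 i, h0 j⟩
        ((hφ0 i).trans (hφ0 j).symm) ⟨hi, hj⟩)
  refine ⟨χ, hχ.mono fun v _ => ?_, by rw [hχφ 0 (h0 0), (hφ0 0).self_of_nhds, hx]⟩
  obtain ⟨k, hk⟩ := exists_nat_gt (‖v‖ / ε)
  refine Set.mem_iUnion.mpr ⟨k, ?_⟩
  rw [mem_ball_zero_iff]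
  rw [div_lt_iff₀ hε] at hk
  nlinarith

theorem exists_norm_le_of_isCompact_range {F X : Type*} [NormedAddCommGroup F]
    [TopologicalSpace X] {q : F → X} (hq : IsOpenMap q) (hc : IsCompact (Set.range q)) :
    ∃ R : ℝ, ∀ v, ∃ u, ‖u‖ ≤ R ∧ q u = q v := by
  obtain ⟨k, hk⟩ := hc.elim_directed_cover (fun k : ℕ => q '' Metric.ball 0 k)
    (fun k => hq _ Metric.isOpen_ball) (by
      rintro _ ⟨v, rfl⟩
      obtain ⟨k, hk⟩ := exists_nat_gt ‖v‖
      exact Set.mem_iUnion.mpr ⟨k, v, by simpa using hk, rfl⟩)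
    (directed_of_isDirected_le fun i j hij =>
      Set.image_mono (Metric.ball_subset_ball (by exact_mod_cast hij)))
  refine ⟨k, fun v => ?_⟩
  obtain ⟨u, hu, he⟩ := hk ⟨v, rfl⟩
  exact ⟨u, by simpa using (mem_ball_zero_iff.mp hu).le, he⟩

/-- The range of `φ` need not be all of `M`, but it is closed: a developing map `ψ` through a point
outside has open range, and if the two ranges met, `ψ` would be `φ` up to an isometry. Being
compact, the range is covered by the image of one ball. -/
theorem IsDevelopingOn.isCobounded_top [CompactSpace M] (hflat : IsFlat n M)
    (hφ : IsDevelopingOn φ Set.univ) : IsCobounded φ ⊤ := by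
  have hcl : IsClosed (Set.range φ) := by
    rw [← isOpen_compl_iff, isOpen_iff_mem_nhds]
    intro y hy
    obtain ⟨ψ, hψ, hψy⟩ := exists_isDevelopingOn_univ hflat y
    have : Set.range ψ ∈ 𝓝 y := hψ.isOpenMap.isOpen_range.mem_nhds ⟨0, hψy⟩
    filter_upwards [this]
    rintro _ ⟨a, rfl⟩ ⟨b, hb⟩
    obtain ⟨g, hg, -⟩ := hψ.exists_isometry hφ hb.symm
    exact hy ⟨g 0, by rw [hg, hψy]⟩
  obtain ⟨R, hR⟩ := exists_norm_le_of_isCompact_range hφ.isOpenMap hcl.isCompact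
  exact ⟨R, fun w _ => let ⟨u, hu, he⟩ := hR w; ⟨u, trivial, hu, he⟩⟩

end Developing

/-! ### The Levi-Civita connection in a flat chart -/

section Connection

open VectorField

variable {n : ℕ} {M : Type u} [TopologicalSpace M] [ChartedSpace (𝔼 n) M]
  [IsManifold (𝓡 n) ∞ M] [RiemannianBundle (fun x : M => TangentSpace (𝓡 n) x)]
  {e : OpenPartialHomeomorph M (𝔼 n)}

/-- The vector field `X` is smooth at `x`. -/
abbrev SmoothFieldAt (X : (x : M) → TangentSpace (𝓡 n) x) (x : M) : Prop :=
  ContMDiffAt (𝓡 n) ((𝓡 n).prod (𝓡 n)) ∞ (fun x => TotalSpace.mk' (𝔼 n) x (X x)) x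

/-- The differential of the chart `e` at `y`, as a map to Euclidean space. -/
def chartDeriv (e : OpenPartialHomeomorph M (𝔼 n)) (y : M) : TangentSpace (𝓡 n) y →L[ℝ] 𝔼 n :=
  mfderiv (𝓡 n) (𝓡 n) e y

theorem IsFlatChart.inner_chartDeriv (he : IsFlatChart e) {y : M} (hy : y ∈ e.source)
    (v w : TangentSpace (𝓡 n) y) : inner ℝ (chartDeriv e y v) (chartDeriv e y w) = inner ℝ v w :=
  he.inner_mfderiv y hy v w

theorem IsFlatChart.chartDeriv_bijective (he : IsFlatChart e) {y : M} (hy : y ∈ e.source) :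
    Function.Bijective (chartDeriv e y) :=
  he.mdifferentiable.mfderiv_bijective hy

/-- The vector field `X` read in the chart `e`. -/
def chartField (e : OpenPartialHomeomorph M (𝔼 n)) (X : (x : M) → TangentSpace (𝓡 n) x)
    (p : 𝔼 n) : 𝔼 n :=
  chartDeriv e (e.symm p) (X (e.symm p))

theorem chartField_apply (X : (x : M) → TangentSpace (𝓡 n) x) {x : M} (hx : x ∈ e.source) :
    chartField e X (e x) = chartDeriv e x (X x) := by
  have h : ∀ y, y = x → chartDeriv e y (X y) = chartDeriv e x (X x) := by
    rintro _ rfl; rfl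
  exact h _ (e.left_inv hx)

theorem IsFlatChart.isInvertible_symm (he : IsFlatChart e) {p : 𝔼 n} (hp : p ∈ e.target) :
    (mfderiv (𝓡 n) (𝓡 n) e.symm p).IsInvertible :=
  ⟨he.mdifferentiable.symm.mfderiv hp, rfl⟩

theorem IsFlatChart.isInvertible (he : IsFlatChart e) {y : M} (hy : y ∈ e.source) :
    (mfderiv (𝓡 n) (𝓡 n) e y).IsInvertible :=
  ⟨he.mdifferentiable.mfderiv hy, rfl⟩

theorem IsFlatChart.mpullback_symm_eq (he : IsFlatChart e) (X : (x : M) → TangentSpace (𝓡 n) x)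
    {p : 𝔼 n} (hp : p ∈ e.target) :
    mpullback (𝓡 n) (𝓡 n) e.symm X p = chartField e X p := by
  have h1 : mfderiv (𝓡 n) (𝓡 n) e.symm p = (he.mdifferentiable.symm.mfderiv hp :
    TangentSpace (𝓡 n) p →L[ℝ] TangentSpace (𝓡 n) (e.symm p)) := rfl
  rw [mpullback_apply, h1, ContinuousLinearMap.inverse_equiv]
  rfl

theorem IsFlatChart.mpullback_symm_eventuallyEq (he : IsFlatChart e)
    (X : (x : M) → TangentSpace (𝓡 n) x) {p : 𝔼 n} (hp : p ∈ e.target) :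
    mpullback (𝓡 n) (𝓡 n) e.symm X =ᶠ[𝓝 p] chartField e X := by
  filter_upwards [e.open_target.mem_nhds hp] with q hq using he.mpullback_symm_eq X hq

theorem IsFlatChart.contDiffAt_chartField (he : IsFlatChart e)
    {X : (x : M) → TangentSpace (𝓡 n) x} {p : 𝔼 n} (hp : p ∈ e.target)
    (hX : SmoothFieldAt X (e.symm p)) : ContDiffAt ℝ ∞ (chartField e X) p := by
  have h1 : SmoothFieldAt (mpullback (𝓡 n) (𝓡 n) e.symm X) p :=
    ContMDiffAt.mpullback_vectorField_preimage hX (he.contMDiffAt_symm hp)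
      (he.isInvertible_symm hp) (by simp)
  exact (contMDiffAt_vectorSpace_iff_contDiffAt.mp h1).congr_of_eventuallyEq
    (he.mpullback_symm_eventuallyEq X hp).symm

theorem IsFlatChart.hasFDerivAt_chartField (he : IsFlatChart e)
    {X : (x : M) → TangentSpace (𝓡 n) x} {x : M} (hx : x ∈ e.source) (hX : SmoothFieldAt X x) :
    HasFDerivAt (chartField e X) (fderiv ℝ (chartField e X) (e x)) (e x) :=
  ((he.contDiffAt_chartField (e.map_source hx) (by rwa [e.left_inv hx])).differentiableAt
    (by simp)).hasFDerivAt

theorem mlieBracket_euclidean (V W : 𝔼 n → 𝔼 n) (p : 𝔼 n) :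
    (mlieBracket (𝓡 n) V W p : 𝔼 n) = fderiv ℝ W p (V p) - fderiv ℝ V p (W p) := by
  have h := congrFun (mlieBracketWithin_eq_lieBracketWithin (𝕜 := ℝ) (E := 𝔼 n) (V := V) (W := W)
    (s := Set.univ)) p
  rw [lieBracketWithin_univ] at h
  exact h

theorem IsFlatChart.chartDeriv_mlieBracket (he : IsFlatChart e)
    {X Y : (x : M) → TangentSpace (𝓡 n) x} {x : M} (hx : x ∈ e.source)
    (hX : SmoothFieldAt X x) (hY : SmoothFieldAt Y x) :
    chartDeriv e x (mlieBracket (𝓡 n) X Y x) =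
      fderiv ℝ (chartField e Y) (e x) (chartField e X (e x)) -
        fderiv ℝ (chartField e X) (e x) (chartField e Y (e x)) := by
  have hp := e.map_source hx
  have hex := e.left_inv hx
  have : IsManifold (𝓡 n) (minSmoothness ℝ 2) M := IsManifold.of_le (n := ∞) (by simp; norm_cast)
  have h1 := mpullback_mlieBracket (n := ∞) (f := e.symm) (x₀ := e x) (V := X) (W := Y)
    (by rw [hex]; exact hX.mdifferentiableAt (by simp))
    (by rw [hex]; exact hY.mdifferentiableAt (by simp)) (he.contMDiffAt_symm hp)
    (by simp; norm_cast)
  rw [he.mpullback_symm_eq _ hp, chartField_apply _ hx] at h1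
  rw [(he.mpullback_symm_eventuallyEq X hp).mlieBracket_vectorField_eq
    (he.mpullback_symm_eventuallyEq Y hp)] at h1
  exact h1.trans (mlieBracket_euclidean _ _ _)

theorem IsFlatChart.mvfderiv_inner (he : IsFlatChart e)
    {Y Z : (x : M) → TangentSpace (𝓡 n) x} {x : M} (hx : x ∈ e.source)
    (hY : SmoothFieldAt Y x) (hZ : SmoothFieldAt Z x) (v : TangentSpace (𝓡 n) x) :
    mvfderiv (𝓡 n) (fun y => inner ℝ (Y y) (Z y)) x v =
      inner ℝ (fderiv ℝ (chartField e Y) (e x) (chartDeriv e x v)) (chartField e Z (e x)) +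
        inner ℝ (fderiv ℝ (chartField e Z) (e x) (chartDeriv e x v)) (chartField e Y (e x)) := by
  have h1 : (fun y => inner ℝ (Y y) (Z y)) =ᶠ[𝓝 x]
      (fun p => inner ℝ (chartField e Y p) (chartField e Z p)) ∘ e := by
    filter_upwards [e.open_source.mem_nhds hx] with y hy
    rw [Function.comp_apply, chartField_apply _ hy, chartField_apply _ hy, he.inner_chartDeriv hy]
  have h2 := (((he.hasFDerivAt_chartField hx hY).inner ℝ
    (he.hasFDerivAt_chartField hx hZ)).hasMFDerivAt.comp x
    ((he.contMDiffAt hx).mdifferentiableAt (by simp)).hasMFDerivAt).congr_of_eventuallyEq h1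
  refine (DFunLike.congr_fun h2.mfderiv v).trans ?_
  change inner ℝ (chartField e Y (e x)) (fderiv ℝ (chartField e Z) (e x) (chartDeriv e x v)) +
    inner ℝ (fderiv ℝ (chartField e Y) (e x) (chartDeriv e x v)) (chartField e Z (e x)) = _
  rw [add_comm, real_inner_comm (chartField e Y (e x))]

/-- In a flat chart the metric has constant coefficients, so the product rule and the coordinate
formula for brackets expand the six Koszul terms; all but two equal contributions cancel. -/
theorem IsFlatChart.koszul_eq (he : IsFlatChart e)
    {X Y Z : (x : M) → TangentSpace (𝓡 n) x} {x : M} (hx : x ∈ e.source)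
    (hX : SmoothFieldAt X x) (hY : SmoothFieldAt Y x) (hZ : SmoothFieldAt Z x) :
    koszul X Y Z x = inner ℝ (fderiv ℝ (chartField e Y) (e x) (chartField e X (e x)))
      (chartField e Z (e x)) := by
  rw [koszul, he.mvfderiv_inner hx hY hZ, he.mvfderiv_inner hx hZ hX, he.mvfderiv_inner hx hX hY]
  rw [← he.inner_chartDeriv hx, ← he.inner_chartDeriv hx, ← he.inner_chartDeriv hx,
    he.chartDeriv_mlieBracket hx hX hY, he.chartDeriv_mlieBracket hx hY hZ,
    he.chartDeriv_mlieBracket hx hZ hX, ← chartField_apply X hx, ← chartField_apply Y hx,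
    ← chartField_apply Z hx]
  simp only [inner_sub_left]
  ring

/-- In a flat chart, the Levi-Civita connection is the componentwise derivative. -/
theorem IsFlatChart.chartDeriv_leviCivita (he : IsFlatChart e)
    {X Y : (x : M) → TangentSpace (𝓡 n) x} {x : M} (hx : x ∈ e.source)
    (hX : SmoothFieldAt X x) (hY : SmoothFieldAt Y x) :
    chartDeriv e x (leviCivita X Y x) =
      fderiv ℝ (chartField e Y) (e x) (chartField e X (e x)) := by
  obtain ⟨v, hv⟩ := (he.chartDeriv_bijective hx).2
    (fderiv ℝ (chartField e Y) (e x) (chartField e X (e x)))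
  rw [← hv]
  congr 1
  rw [leviCivita]
  conv_rhs => rw [← (stdOrthonormalBasis ℝ (TangentSpace (𝓡 n) x)).sum_repr' v]
  refine Finset.sum_congr rfl fun i _ => ?_
  congr 1
  rw [he.koszul_eq hx hX hY (FiberBundle.contMDiffAt_extend _ _ _),
    chartField_apply (FiberBundle.extend _ _) hx,
    FiberBundle.extend_apply_self, ← hv, he.inner_chartDeriv hx,
    real_inner_comm]

end Connection

/-! ### Moving frames with constant span -/

section Span

variable {E : Type*} [NormedAddCommGroup E] [NormedSpace ℝ E] [FiniteDimensional ℝ E]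

/-- A differentiable moving frame whose derivatives lie in its span has locally constant span. -/
theorem eventually_span_eq_of_fderiv_mem {k : ℕ} {Y : Fin k → E → E} {O : Set E} (hO : IsOpen O)
    (hd : ∀ i, ∀ p ∈ O, DifferentiableAt ℝ (Y i) p)
    (hli : ∀ p ∈ O, LinearIndependent ℝ fun i => Y i p)
    (hY : ∀ i, ∀ p ∈ O, ∀ u, fderiv ℝ (Y i) p u ∈ Submodule.span ℝ (Set.range fun i => Y i p))
    {p₀ : E} (hp₀ : p₀ ∈ O) :
    ∀ᶠ p in 𝓝 p₀, Submodule.span ℝ (Set.range fun i => Y i p) =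
      Submodule.span ℝ (Set.range fun i => Y i p₀) := by
  let pr : Fin k → ((Fin k → ℝ) →L[ℝ] ℝ) := fun i => ContinuousLinearMap.proj i
  let A : E → ((Fin k → ℝ) →L[ℝ] E) := fun p => ∑ i, (pr i).smulRight (Y i p)
  have hA : ∀ p c, A p c = ∑ i, c i • Y i p := fun p c => by simp [A, pr]
  have hAr : ∀ p, LinearMap.range (A p).toLinearMap =
      Submodule.span ℝ (Set.range fun i => Y i p) := fun p => by
    ext x
    rw [Submodule.mem_span_range_iff_exists_fun]
    simp [hA]
  have hAi : ∀ p ∈ O, Function.Injective (A p) := fun p hp => by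
    rw [injective_iff_map_eq_zero]
    intro c hc
    rw [hA] at hc
    exact funext (Fintype.linearIndependent_iff.mp (hli p hp) c hc)
  let A' : E → (E →L[ℝ] (Fin k → ℝ) →L[ℝ] E) := fun p =>
    ∑ i, (ContinuousLinearMap.smulRightL ℝ (Fin k → ℝ) E (pr i)).comp (fderiv ℝ (Y i) p)
  have hA' : ∀ p u c, A' p u c = ∑ i, c i • fderiv ℝ (Y i) p u := fun p u c => by simp [A', pr]
  have hAd : ∀ p ∈ O, HasFDerivAt A (A' p) p := fun p hp => by
    refine HasFDerivAt.fun_sum fun i _ => ?_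
    exact (ContinuousLinearMap.smulRightL ℝ (Fin k → ℝ) E (pr i)).hasFDerivAt.comp p
      (hd i p hp).hasFDerivAt
  obtain ⟨L₀, hL₀⟩ := (A p₀).toLinearMap.exists_leftInverse_of_injective
    (LinearMap.ker_eq_bot.mpr (hAi p₀ hp₀))
  let L : E →L[ℝ] (Fin k → ℝ) := L₀.toContinuousLinearMap
  let B : E → ((Fin k → ℝ) →L[ℝ] (Fin k → ℝ)) := fun p => L.comp (A p)
  have hB0 : B p₀ = 1 := by
    ext1 c
    exact LinearMap.congr_fun hL₀ c
  have hBd : ∀ p ∈ O, DifferentiableAt ℝ B p := fun p hp =>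
    (differentiableAt_const L).clm_comp (hAd p hp).differentiableAt
  have hunit : ∀ᶠ p in 𝓝 p₀, IsUnit (B p) :=
    (hBd p₀ hp₀).continuousAt.eventually_mem (Units.isOpen.mem_nhds (by rw [hB0]; exact isUnit_one))
  obtain ⟨r, hr, hball⟩ := Metric.mem_nhds_iff.mp (inter_mem (hO.mem_nhds hp₀) hunit)
  let R : E → ((Fin k → ℝ) →L[ℝ] (Fin k → ℝ)) := fun p => Ring.inverse (B p)
  have hR : ∀ p ∈ Metric.ball p₀ r, DifferentiableAt ℝ R p := fun p hp =>
    (differentiableAt_inverse (hball hp).2).comp p (hBd p (hball hp).1)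
  -- This renormalises the frame so that `L ∘ S = 1`. Then `L` kills the derivative of `S`, which
  -- has values in the range of `A p`, where `L` is injective; hence `S` is constant.
  let S : E → ((Fin k → ℝ) →L[ℝ] E) := fun p => (A p).comp (R p)
  have hBR : ∀ p ∈ Metric.ball p₀ r, (B p).comp (R p) = 1 := fun p hp =>
    Ring.mul_inverse_cancel _ (hball hp).2
  have hRB : ∀ p ∈ Metric.ball p₀ r, (R p).comp (B p) = 1 := fun p hp =>
    Ring.inverse_mul_cancel _ (hball hp).2
  have hSd : ∀ p ∈ Metric.ball p₀ r, HasFDerivAt S (0 : E →L[ℝ] (Fin k → ℝ) →L[ℝ] E) p := by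
    intro p hp
    have h1 := (hAd p (hball hp).1).clm_comp (hR p hp).hasFDerivAt
    have h2 : HasFDerivAt (fun q => L.comp (S q)) (0 : E →L[ℝ] (Fin k → ℝ) →L[ℝ] (Fin k → ℝ)) p := by
      refine (hasFDerivAt_const (1 : (Fin k → ℝ) →L[ℝ] (Fin k → ℝ)) p).congr_of_eventuallyEq ?_
      filter_upwards [Metric.isOpen_ball.mem_nhds hp] with q hq using hBR q hq
    have h3 := h2.unique ((hasFDerivAt_const L p).clm_comp h1)
    convert h1 using 1
    ext1 u
    ext1 c
    have h4 : (fderiv ℝ S p u) c = A p (fderiv ℝ R p u c) + A' p u (R p c) := by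
      rw [h1.fderiv]; simp
    rw [← h1.fderiv]
    have h5 : L (fderiv ℝ S p u c) = 0 := by
      have := congrArg (fun T => T u c) h3
      rw [← h1.fderiv] at this
      simpa using this.symm
    have h6 : fderiv ℝ S p u c ∈ LinearMap.range (A p).toLinearMap := by
      rw [h4, hA' p u]
      refine add_mem ⟨_, rfl⟩ (Submodule.sum_mem _ fun i _ => Submodule.smul_mem _ _ ?_)
      rw [hAr]
      exact hY i p (hball hp).1 u
    obtain ⟨d, hd⟩ := h6
    have h7 : B p d = 0 := by
      rw [← h5, ← hd]; rfl
    have h8 : d = 0 := by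
      have := congrArg (fun T => T d) (hRB p hp)
      simpa [h7] using this.symm
    rw [← hd, h8]
    simp
  have hSr : ∀ p ∈ Metric.ball p₀ r, LinearMap.range (S p).toLinearMap =
      Submodule.span ℝ (Set.range fun i => Y i p) := fun p hp => by
    rw [← hAr]
    apply le_antisymm
    · rintro _ ⟨c, rfl⟩
      exact ⟨R p c, rfl⟩
    · rintro _ ⟨c, rfl⟩
      refine ⟨B p c, ?_⟩
      have := congrArg (fun T => A p (T c)) (hRB p hp)
      exact this
  have hp₀b := Metric.mem_ball_self (x := p₀) hr
  filter_upwards [Metric.isOpen_ball.mem_nhds hp₀b] with p hp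
  rw [← hSr p hp, ← hSr p₀ hp₀b]
  rw [Metric.isOpen_ball.is_const_of_fderiv_eq_zero (convex_ball p₀ r).isPreconnected
    (fun q hq => (hSd q hq).differentiableAt.differentiableWithinAt)
    (fun q hq => (hSd q hq).fderiv) hp hp₀b]

/-- Composing with the projection that has kernel `W` turns the claim into the vanishing of the
derivative of a locally zero map. -/
theorem fderiv_mem_of_eventually_mem {F : Type*} [NormedAddCommGroup F] [NormedSpace ℝ F]
    {f : F → E} {f' : F →L[ℝ] E} {p : F} (hf : HasFDerivAt f f' p) {W : Submodule ℝ E}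
    (hW : ∀ᶠ q in 𝓝 p, f q ∈ W) (u : F) : f' u ∈ W := by
  obtain ⟨L₀, hL₀⟩ := W.exists_isCompl
  let P : E →L[ℝ] L₀ := (L₀.projectionOnto W hL₀.symm).toContinuousLinearMap
  have hP : ∀ x, P x = 0 ↔ x ∈ W := fun x => by
    exact Submodule.projectionOnto_apply_eq_zero_iff hL₀.symm
  have h1 : HasFDerivAt (fun q => P (f q)) (0 : F →L[ℝ] L₀) p := by
    refine (hasFDerivAt_const (0 : L₀) p).congr_of_eventuallyEq ?_
    filter_upwards [hW] with q hq using (hP _).mpr hq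
  have h2 := h1.unique (P.hasFDerivAt.comp p hf)
  rw [← hP]
  exact (congrArg (fun T => T u) h2).symm

end Span

/-! ### Parallel distributions as constant subspaces -/

section Parallel

open VectorField

variable {n : ℕ} {M : Type u} [TopologicalSpace M] [ChartedSpace (𝔼 n) M]
  [IsManifold (𝓡 n) ∞ M] [RiemannianBundle (fun x : M => TangentSpace (𝓡 n) x)]
  {e : OpenPartialHomeomorph M (𝔼 n)} {φ : 𝔼 n → M}
  {D : (x : M) → Submodule ℝ (TangentSpace (𝓡 n) x)} {W : Submodule ℝ (𝔼 n)}

/-- The differential of a map from Euclidean space. -/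
def devDeriv (φ : 𝔼 n → M) (v : 𝔼 n) : 𝔼 n →L[ℝ] TangentSpace (𝓡 n) (φ v) :=
  mfderiv (𝓡 n) (𝓡 n) φ v

/-- The distribution `D` pulled back by `φ` is the constant distribution `W`. -/
def PullsBackTo (φ : 𝔼 n → M) (D : (x : M) → Submodule ℝ (TangentSpace (𝓡 n) x))
    (W : Submodule ℝ (𝔼 n)) : Prop :=
  ∀ v u, devDeriv φ v u ∈ D (φ v) ↔ u ∈ W

theorem IsFlatChart.contMDiffAt_of_eventuallyEq (he : IsFlatChart e) {p : 𝔼 n} (hp : p ∈ e.target)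
    (h : φ =ᶠ[𝓝 p] e.symm) : ContMDiffAt (𝓡 n) (𝓡 n) ∞ φ p :=
  (he.contMDiffAt_symm hp).congr_of_eventuallyEq h

theorem mem_source_of_eventuallyEq {p : 𝔼 n} (hp : p ∈ e.target) (h : φ =ᶠ[𝓝 p] e.symm) :
    φ p ∈ e.source := by
  rw [h.self_of_nhds]
  exact e.map_target hp

theorem IsFlatChart.chartDeriv_devDeriv (he : IsFlatChart e) {p : 𝔼 n} (hp : p ∈ e.target)
    (h : φ =ᶠ[𝓝 p] e.symm) (u : 𝔼 n) : chartDeriv e (φ p) (devDeriv φ p u) = u := by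
  have h1 : e ∘ φ =ᶠ[𝓝 p] id := by
    filter_upwards [h, e.open_target.mem_nhds hp] with q hq hqe
    rw [Function.comp_apply, hq, e.right_inv hqe, id]
  have h2 := h1.mfderiv_eq (I := 𝓡 n) (I' := 𝓡 n)
  rw [mfderiv_id, mfderiv_comp p
    ((he.contMDiffAt (mem_source_of_eventuallyEq hp h)).mdifferentiableAt (by simp))
    ((he.contMDiffAt_of_eventuallyEq hp h).mdifferentiableAt (by simp))] at h2
  exact DFunLike.congr_fun h2 u

theorem IsFlatChart.devDeriv_chartDeriv (he : IsFlatChart e) {p : 𝔼 n} (hp : p ∈ e.target)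
    (h : φ =ᶠ[𝓝 p] e.symm) (v : TangentSpace (𝓡 n) (φ p)) :
    devDeriv φ p (chartDeriv e (φ p) v) = v :=
  (he.chartDeriv_bijective (mem_source_of_eventuallyEq hp h)).1 (he.chartDeriv_devDeriv hp h _)

theorem PullsBackTo.mem_iff (hW : PullsBackTo φ D W) (he : IsFlatChart e) {y : M}
    (hy : y ∈ e.source) (h : φ =ᶠ[𝓝 (e y)] e.symm) (v : TangentSpace (𝓡 n) y) :
    v ∈ D y ↔ chartDeriv e y v ∈ W := by
  have hp := e.map_source hy
  have key : ∀ z, z = φ (e y) → ∀ v : TangentSpace (𝓡 n) z, v ∈ D z ↔ chartDeriv e z v ∈ W := by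
    rintro _ rfl v
    rw [← hW (e y), he.devDeriv_chartDeriv hp h]
  exact key y (by rw [h.self_of_nhds, e.left_inv hy]) v

/-- The vector field that is constant, equal to `u`, in the chart `e`. -/
def constField (e : OpenPartialHomeomorph M (𝔼 n)) (u : 𝔼 n) (y : M) : TangentSpace (𝓡 n) y :=
  mpullback (𝓡 n) (𝓡 n) e (fun _ => u) y

theorem IsFlatChart.chartDeriv_constField (he : IsFlatChart e) (u : 𝔼 n) {y : M}
    (hy : y ∈ e.source) : chartDeriv e y (constField e u y) = u := by
  have h1 : mfderiv (𝓡 n) (𝓡 n) e y = (he.mdifferentiable.mfderiv hy :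
    TangentSpace (𝓡 n) y →L[ℝ] TangentSpace (𝓡 n) (e y)) := rfl
  have h2 : constField e u y = (he.mdifferentiable.mfderiv hy).symm u := by
    change (mfderiv (𝓡 n) (𝓡 n) e y).inverse u = _
    rw [h1, ContinuousLinearMap.inverse_equiv]
    rfl
  rw [h2]
  exact (he.mdifferentiable.mfderiv hy).apply_symm_apply u

theorem IsFlatChart.smoothFieldAt_constField (he : IsFlatChart e) (u : 𝔼 n) {y : M}
    (hy : y ∈ e.source) : SmoothFieldAt (constField e u) y :=
  ContMDiffAt.mpullback_vectorField_preimage (V := fun _ => u)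
    (contMDiffAt_vectorSpace_iff_contDiffAt.mpr contDiffAt_const) (he.contMDiffAt hy)
    (he.isInvertible hy) (by simp)

theorem chartField_mem_span {k : ℕ} {Y : Fin k → (y : M) → TangentSpace (𝓡 n) y} {p : 𝔼 n} :
    Submodule.span ℝ (Set.range fun i => chartField e (Y i) p) =
      (Submodule.span ℝ (Set.range fun i => Y i (e.symm p))).map
        (chartDeriv e (e.symm p)).toLinearMap := by
  rw [Submodule.map_span, ← Set.range_comp]
  rfl

/-- A parallel distribution is constant in a developing map. -/
theorem IsDevelopingOn.exists_pullsBackTo (hφ : IsDevelopingOn φ Set.univ)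
    (hD : IsDistribution D) (hpar : IsParallel D) : ∃ W, PullsBackTo φ D W := by
  let W : 𝔼 n → Submodule ℝ (𝔼 n) := fun v => (D (φ v)).comap (devDeriv φ v).toLinearMap
  have hloc : IsLocallyConstant W := by
    rw [IsLocallyConstant.iff_eventually_eq]
    intro v
    obtain ⟨e, he, hve, heq⟩ := hφ v (Set.mem_univ v)
    obtain ⟨U, k, Y, hU, hxU, hYs, hY⟩ := hD (e.symm v)
    let O := e.target ∩ e.symm ⁻¹' U
    have hO : IsOpen O := e.symm.isOpen_inter_preimage hU
    have hYat : ∀ i, ∀ y ∈ U, SmoothFieldAt (Y i) y := fun i y hy =>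
      (hYs i y hy).contMDiffAt (hU.mem_nhds hy)
    have hcf : ∀ i, ∀ p ∈ O, DifferentiableAt ℝ (chartField e (Y i)) p := fun i p hp =>
      (he.contDiffAt_chartField hp.1 (hYat i _ hp.2)).differentiableAt (by simp)
    have hspan := eventually_span_eq_of_fderiv_mem hO hcf
      (fun p hp => ((hY _ hp.2).1).map' (chartDeriv e (e.symm p)).toLinearMap
        (LinearMap.ker_eq_bot.mpr (he.chartDeriv_bijective (e.map_target hp.1)).1))
      -- Parallelism is applied to the field that is constant `u` in the chart: its covariant
      -- derivative of `Y i` is the ordinary derivative in direction `u`, which therefore stays in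
      -- the span of the frame.
      (fun i p hp u => by
        have hps := e.map_target hp.1
        have h1 := hpar (U ∩ e.source) (constField e u) (Y i) (hU.inter e.open_source)
          (fun y hy => (he.smoothFieldAt_constField u hy.2).contMDiffWithinAt)
          ((hYs i).mono Set.inter_subset_left)
          (fun y hy => by
            rw [← (hY y hy.1).2]
            exact Submodule.subset_span ⟨i, rfl⟩) (e.symm p) ⟨hp.2, hps⟩
        have h2 := he.chartDeriv_leviCivita hps (he.smoothFieldAt_constField u hps)
          (hYat i _ hp.2)
        rw [chartField_apply _ hps, he.chartDeriv_constField u hps, e.right_inv hp.1] at h2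
        rw [← h2, chartField_mem_span, (hY _ hp.2).2]
        exact Submodule.mem_map_of_mem h1) (show v ∈ O from ⟨hve, hxU⟩)
    have hWO : ∀ p ∈ O, φ =ᶠ[𝓝 p] e.symm →
        W p = Submodule.span ℝ (Set.range fun i => chartField e (Y i) p) := by
      intro p hp hpe
      have key : ∀ z (hz : z = φ p), W p = (D z).map (chartDeriv e z).toLinearMap := by
        rintro _ rfl
        ext u
        constructor
        · intro hu
          exact ⟨_, hu, he.chartDeriv_devDeriv hp.1 hpe u⟩
        · rintro ⟨w, hw, rfl⟩
          change devDeriv φ p (chartDeriv e (φ p) w) ∈ D (φ p)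
          rwa [he.devDeriv_chartDeriv hp.1 hpe]
      rw [chartField_mem_span, (hY _ hp.2).2]
      exact key _ hpe.self_of_nhds.symm
    filter_upwards [hspan, hO.mem_nhds (show v ∈ O from ⟨hve, hxU⟩),
      eventually_eventuallyEq_nhds.mpr heq] with p h1 h2 h3
    rw [hWO p h2 h3, h1, hWO v ⟨hve, hxU⟩ heq]
  refine ⟨W 0, fun v u => ?_⟩
  rw [hloc.apply_eq_of_preconnectedSpace 0 v]
  rfl

theorem isDistribution_of_pullsBackTo
    (h : ∀ x, ∃ φ : 𝔼 n → M, IsDevelopingOn φ Set.univ ∧ φ 0 = x ∧ ∃ W, PullsBackTo φ D W) :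
    IsDistribution D := by
  intro x
  obtain ⟨φ, hφ, rfl, W, hW⟩ := h x
  obtain ⟨e, he, h0, heq⟩ := hφ 0 (Set.mem_univ _)
  obtain ⟨O, hOe, hO, h0O⟩ := eventually_nhds_iff.mp (eventually_eventuallyEq_nhds.mpr heq)
  let b := Module.finBasis ℝ W
  refine ⟨e.source ∩ e ⁻¹' O, Module.finrank ℝ W, fun i => constField e (b i : 𝔼 n),
    e.isOpen_inter_preimage hO, ⟨mem_source_of_eventuallyEq h0 heq, ?_⟩,
    fun i y hy => (he.smoothFieldAt_constField _ hy.1).contMDiffWithinAt, fun y hy => ?_⟩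
  · rw [Set.mem_preimage, heq.self_of_nhds, e.right_inv h0]
    exact h0O
  · have hb : (chartDeriv e y).toLinearMap ∘ (fun i => constField e (b i : 𝔼 n) y) =
        fun i => (b i : 𝔼 n) := funext fun i => he.chartDeriv_constField _ hy.1
    refine ⟨?_, ?_⟩
    · refine LinearIndependent.of_comp (chartDeriv e y).toLinearMap ?_
      rw [hb]
      exact b.linearIndependent.map' W.subtype W.ker_subtype
    · have hinj : Function.Injective (Submodule.map (chartDeriv e y).toLinearMap) :=
        Submodule.map_injective_of_injective (he.chartDeriv_bijective hy.1).1
      apply hinj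
      rw [Submodule.map_span, ← Set.range_comp, hb]
      have h1 : Submodule.span ℝ (Set.range fun i => (b i : 𝔼 n)) = W := by
        have : (Set.range fun i => (b i : 𝔼 n)) = W.subtype '' Set.range b := by
          rw [← Set.range_comp]; rfl
        rw [this, ← Submodule.map_span, b.span_eq, Submodule.map_top, Submodule.range_subtype]
      rw [h1]
      ext u
      constructor
      · intro hu
        refine ⟨constField e u y, (hW.mem_iff he hy.1 (hOe _ hy.2) _).mpr ?_,
          he.chartDeriv_constField u hy.1⟩
        rwa [he.chartDeriv_constField u hy.1]
      · rintro ⟨w, hw, rfl⟩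
        exact (hW.mem_iff he hy.1 (hOe _ hy.2) _).mp hw

theorem isParallel_of_pullsBackTo
    (h : ∀ x, ∃ φ : 𝔼 n → M, IsDevelopingOn φ Set.univ ∧ φ 0 = x ∧ ∃ W, PullsBackTo φ D W) :
    IsParallel D := by
  intro U X Y hU hX hY hYD x hx
  obtain ⟨φ, hφ, rfl, W, hW⟩ := h x
  obtain ⟨e, he, h0, heq⟩ := hφ 0 (Set.mem_univ _)
  have hxs := mem_source_of_eventuallyEq h0 heq
  have he0 : e (φ 0) = 0 := by rw [heq.self_of_nhds, e.right_inv h0]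
  rw [hW.mem_iff he hxs (by rwa [he0]), he.chartDeriv_leviCivita hxs
    ((hX _ hx).contMDiffAt (hU.mem_nhds hx)) ((hY _ hx).contMDiffAt (hU.mem_nhds hx))]
  refine fderiv_mem_of_eventually_mem (he.hasFDerivAt_chartField hxs
    ((hY _ hx).contMDiffAt (hU.mem_nhds hx))) ?_ _
  rw [he0]
  have h1 : ∀ᶠ p in 𝓝 0, e.symm p ∈ U := (e.continuousAt_symm h0).eventually_mem
    (hU.mem_nhds (heq.self_of_nhds ▸ hx))
  filter_upwards [eventually_eventuallyEq_nhds.mpr heq, h1, e.open_target.mem_nhds h0]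
    with p hp hpU hpe
  exact (hW.mem_iff he (e.map_target hpe) (by rwa [e.right_inv hpe]) _).mp (hYD _ hpU)

end Parallel

/-! ### The image of a homogeneous map as an immersed manifold -/

section ImageManifold

/-- An isometry that preserves `φ` and takes one point of the range of `j` to another maps this
range to itself, since its linear part does; it thus restricts to an isometry of `F`. -/
theorem IsHomogeneous.comp_linearIsometry {E F X : Type*} [NormedAddCommGroup E]
    [InnerProductSpace ℝ E] [NormedAddCommGroup F] [InnerProductSpace ℝ F]
    [FiniteDimensional ℝ F] [TopologicalSpace X] {φ : E → X} (hφ : IsHomogeneous φ)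
    (j : F →ₗᵢ[ℝ] E) (hj : IsHolonomyInvariant φ (LinearMap.range j.toLinearMap)) :
    IsHomogeneous (φ ∘ j) where
  continuous := hφ.continuous.comp j.continuous
  locallyInjective a := by
    obtain ⟨U, hU, hinj⟩ := hφ.locallyInjective (j a)
    refine ⟨j ⁻¹' U, j.continuous.continuousAt hU, fun x hx y hy h => ?_⟩
    exact j.injective (hinj hx hy h)
  exists_isometry a b h := by
    obtain ⟨g, hg, hga⟩ := hφ.exists_isometry _ _ h
    choose f hf using fun x => hj g hg (j x) ⟨x, rfl⟩
    replace hf : ∀ x, j (f x) = g.linearIsometryEquiv (j x) := hf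
    let L : F →ₗᵢ[ℝ] F :=
      { toFun := f
        map_add' := fun x y => j.injective (by simp [hf])
        map_smul' := fun c x => j.injective (by simp [hf])
        norm_map' := fun x => by
          change ‖f x‖ = ‖x‖
          rw [← j.norm_map, hf, LinearIsometryEquiv.norm_map, j.norm_map] }
    let L' : F ≃ₗᵢ[ℝ] F := L.toLinearIsometryEquiv rfl
    let k : F ≃ᵃⁱ[ℝ] F := ((AffineIsometryEquiv.vaddConst ℝ a).symm.trans
      L'.toAffineIsometryEquiv).trans (AffineIsometryEquiv.vaddConst ℝ b)
    have hk : ∀ x, k x = f (x - a) + b := fun x => rfl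
    have hjk : ∀ x, j (k x) = g (j x) := fun x => by
      rw [hk, map_add, hf, isometry_apply_eq g (j a), hga, map_sub]
    refine ⟨k, fun v => ?_, j.injective ?_⟩
    · rw [Function.comp_apply, hjk, hg, Function.comp_apply]
    · rw [hjk, hga]

variable {k : ℕ} {X : Type u} [TopologicalSpace X] {ψ : 𝔼 k → X}

/-- The image of a homogeneous map, with the quotient topology. -/
def ImageManifold (ψ : 𝔼 k → X) : Type u := Set.range ψ

namespace ImageManifold

/-- The projection onto the image. -/
def proj (ψ : 𝔼 k → X) : 𝔼 k → ImageManifold ψ := Set.rangeFactorization ψ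

/-- The inclusion of the image. -/
def incl (ψ : 𝔼 k → X) : ImageManifold ψ → X := Subtype.val

theorem incl_injective : Function.Injective (incl ψ) := Subtype.val_injective

theorem range_incl : Set.range (incl ψ) = Set.range ψ := Subtype.range_val

theorem proj_surjective : Function.Surjective (proj ψ) := Set.rangeFactorization_surjective

theorem proj_eq_iff {a b : 𝔼 k} : proj ψ a = proj ψ b ↔ ψ a = ψ b := Subtype.ext_iff

instance : TopologicalSpace (ImageManifold ψ) := .coinduced (proj ψ) inferInstance

theorem continuous_proj : Continuous (proj ψ) := continuous_coinduced_rng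

/-- The saturation of an open set is a union of its preimages under isometries preserving `ψ`. -/
theorem isOpenMap_proj (hψ : IsHomogeneous ψ) : IsOpenMap (proj ψ) := by
  intro O hO
  refine isOpen_coinduced.mpr (isOpen_iff_mem_nhds.mpr ?_)
  rintro a ⟨o, ho, hoa⟩
  obtain ⟨g, hg, rfl⟩ := hψ.exists_isometry a o (proj_eq_iff.mp hoa).symm
  filter_upwards [g.continuous.continuousAt (hO.mem_nhds ho)] with b hb
  exact ⟨g b, hb, proj_eq_iff.mpr (hg b)⟩

theorem exists_chart (hψ : IsHomogeneous ψ) (a : 𝔼 k) :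
    ∃ c : OpenPartialHomeomorph (ImageManifold ψ) (𝔼 k),
      a ∈ c.target ∧ ⇑c.symm = proj ψ := by
  obtain ⟨U, hU, hinj⟩ := hψ.locallyInjective a
  obtain ⟨V, hVU, hV, ha⟩ := mem_nhds_iff.mp hU
  have hi : Set.InjOn (proj ψ) V := fun x hx y hy h =>
    hinj (hVU hx) (hVU hy) (proj_eq_iff.mp h)
  exact ⟨(OpenPartialHomeomorph.ofContinuousOpen (hi.toPartialEquiv _ _)
    continuous_proj.continuousOn (isOpenMap_proj hψ) hV).symm, ha, rfl⟩

/-- The charts are the local inverses of the projection. -/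
abbrev chartedSpace (hψ : IsHomogeneous ψ) : ChartedSpace (𝔼 k) (ImageManifold ψ) where
  atlas := {c | ⇑c.symm = proj ψ}
  chartAt y := (exists_chart hψ (proj_surjective y).choose).choose
  mem_chart_source y := by
    have h := (exists_chart hψ (proj_surjective y).choose).choose_spec
    have h1 := OpenPartialHomeomorph.map_target _ h.1
    rwa [h.2, (proj_surjective y).choose_spec] at h1
  chart_mem_atlas y := (exists_chart hψ (proj_surjective y).choose).choose_spec.2

/-- Two local inverses of the projection differ, near each point, by an isometry preserving `ψ`, so
the transition maps are smooth. -/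
theorem isManifold (hψ : IsHomogeneous ψ) :
    letI := chartedSpace hψ
    IsManifold (𝓡 k) ∞ (ImageManifold ψ) := by
  let := chartedSpace hψ
  refine isManifold_of_contDiffOn (𝓡 k) ∞ _ fun c c' hc hc' => ?_
  replace hc : ⇑c.symm = proj ψ := hc
  replace hc' : ⇑c'.symm = proj ψ := hc'
  rintro p ⟨⟨hp, hp'⟩, -⟩
  change p ∈ c.target at hp
  change c.symm p ∈ c'.source at hp'
  refine ContDiffAt.contDiffWithinAt ?_
  change ContDiffAt ℝ ∞ (c' ∘ c.symm) p
  have h1 : proj ψ (c' (proj ψ p)) = proj ψ p := by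
    have := c'.left_inv hp'
    rwa [hc', hc] at this
  obtain ⟨g, hg, hgp⟩ := hψ.exists_isometry p _ (proj_eq_iff.mp h1.symm)
  have h2 : c' (proj ψ p) ∈ c'.target := c'.map_source (hc ▸ hp')
  refine (contDiff_isometry g).contDiffAt.congr_of_eventuallyEq ?_
  filter_upwards [g.continuous.continuousAt (c'.open_target.mem_nhds (hgp ▸ h2))] with q hq
  have h3 : proj ψ q = proj ψ (g q) := proj_eq_iff.mpr (hg q).symm
  rw [Function.comp_apply, hc, h3, ← hc', c'.right_inv hq]

theorem connectedSpace : ConnectedSpace (ImageManifold ψ) :=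
  proj_surjective.connectedSpace continuous_proj

end ImageManifold

variable {n : ℕ} {M : Type u} [TopologicalSpace M] [ChartedSpace (𝔼 n) M]
  [IsManifold (𝓡 n) ∞ M] {D : (x : M) → Submodule ℝ (TangentSpace (𝓡 n) x)} {ψ : 𝔼 k → M}

open ImageManifold in
theorem ImageManifold.isConnectedIntegralManifold (hψ : IsHomogeneous ψ)
    (hs : ContMDiff (𝓡 k) (𝓡 n) ∞ ψ)
    (hinj : ∀ a, Function.Injective (mfderiv (𝓡 k) (𝓡 n) ψ a))
    (hD : ∀ a, LinearMap.range (mfderiv (𝓡 k) (𝓡 n) ψ a).toLinearMap = D (ψ a)) :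
    letI := chartedSpace hψ
    IsConnectedIntegralManifold D k (incl ψ) := by
  let := chartedSpace hψ
  have hm : IsManifold (𝓡 k) ∞ (ImageManifold ψ) := isManifold hψ
  have hsm : ContMDiff (𝓡 k) (𝓡 n) ∞ (incl ψ) := by
    intro y
    obtain ⟨a, rfl⟩ := proj_surjective y
    obtain ⟨c, hca, hc⟩ := exists_chart hψ a
    have hcy : proj ψ a ∈ c.source := hc ▸ c.map_target hca
    have hcm : c ∈ IsManifold.maximalAtlas (𝓡 k) ∞ (ImageManifold ψ) :=
      IsManifold.subset_maximalAtlas hc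
    refine (hs.contMDiffAt.comp _ (contMDiffAt_of_mem_maximalAtlas hcm hcy)).congr_of_eventuallyEq
      ?_
    filter_upwards [c.open_source.mem_nhds hcy] with z hz
    change incl ψ z = incl ψ (proj ψ (c z))
    rw [← hc, c.left_inv hz]
  have hproj : ∀ a, MDifferentiableAt (𝓡 k) (𝓡 k) (proj ψ) a ∧
      Function.Bijective (mfderiv (𝓡 k) (𝓡 k) (proj ψ) a) := by
    intro a
    obtain ⟨c, hca, hc⟩ := exists_chart hψ a
    have hcm : c ∈ atlas (𝔼 k) (ImageManifold ψ) := hc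
    have h1 := mdifferentiable_of_mem_atlas (I := 𝓡 k) hcm
    have h2 := h1.mdifferentiableAt_symm hca
    have h3 := h1.symm.mfderiv_bijective hca
    rw [hc] at h2 h3
    exact ⟨h2, h3⟩
  have hcomp : ∀ a, mfderiv (𝓡 k) (𝓡 n) ψ a =
      (mfderiv (𝓡 k) (𝓡 n) (incl ψ) (proj ψ a)).comp (mfderiv (𝓡 k) (𝓡 k) (proj ψ) a) :=
    fun a => mfderiv_comp a (hsm.mdifferentiableAt (by simp)) (hproj a).1
  refine ⟨hm, connectedSpace, hsm, incl_injective, fun y => ?_, fun y => ?_⟩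
  · obtain ⟨a, rfl⟩ := proj_surjective y
    intro v w hvw
    obtain ⟨v, rfl⟩ := (hproj a).2.2 v
    obtain ⟨w, rfl⟩ := (hproj a).2.2 w
    have h1 := hinj a
    rw [hcomp a] at h1
    rw [h1 hvw]
  · obtain ⟨a, rfl⟩ := proj_surjective y
    refine Eq.trans ?_ (hD a)
    rw [hcomp a]
    ext x
    constructor
    · rintro ⟨v, rfl⟩
      obtain ⟨w, rfl⟩ := (hproj a).2.2 v
      exact ⟨w, rfl⟩
    · rintro ⟨w, rfl⟩
      exact ⟨_, rfl⟩

end ImageManifold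

/-! ### Maps whose derivatives take values in a fixed subspace -/

section Submodule

variable {E F : Type*} [NormedAddCommGroup E] [NormedSpace ℝ E] [FiniteDimensional ℝ E]
  [NormedAddCommGroup F] [NormedSpace ℝ F] {W : Submodule ℝ E} {f : F → E}

theorem sub_mem_of_fderiv_mem {s : Set F} (hs : IsOpen s) (hc : Convex ℝ s)
    (hf : ∀ q ∈ s, DifferentiableAt ℝ f q) (hW : ∀ q ∈ s, ∀ u, fderiv ℝ f q u ∈ W) {p q : F}
    (hp : p ∈ s) (hq : q ∈ s) : f q - f p ∈ W := by
  obtain ⟨L₀, hL₀⟩ := W.exists_isCompl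
  let P : E →L[ℝ] L₀ := (L₀.projectionOnto W hL₀.symm).toContinuousLinearMap
  have hP : ∀ x, P x = 0 ↔ x ∈ W := fun x =>
    Submodule.projectionOnto_apply_eq_zero_iff hL₀.symm
  have h1 : ∀ x ∈ s, HasFDerivAt (fun y => P (f y)) (0 : F →L[ℝ] L₀) x := fun x hx => by
    have h2 : P.comp (fderiv ℝ f x) = 0 := by
      ext1 u
      exact (hP _).mpr (hW x hx u)
    exact h2 ▸ P.hasFDerivAt.comp x (hf x hx).hasFDerivAt
  have h2 := hs.is_const_of_fderiv_eq_zero hc.isPreconnected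
    (fun x hx => (h1 x hx).differentiableAt.differentiableWithinAt) (fun x hx => (h1 x hx).fderiv)
    hq hp
  rw [← hP, map_sub, sub_eq_zero]
  exact h2

/-- After projection to `W` the derivative is onto, so the image of a neighbourhood is a
neighbourhood in `W`. On the translate `f p + W` the projection is injective, which lifts this back
to `E`. -/
theorem eventually_mem_image_of_range_eq [CompleteSpace F] {f' : F →L[ℝ] E} {p : F}
    (hf : HasStrictFDerivAt f f' p) (hr : LinearMap.range f'.toLinearMap = W)
    (hW : ∀ᶠ q in 𝓝 p, f q - f p ∈ W) {O : Set F} (hO : O ∈ 𝓝 p) :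
    ∀ᶠ w in 𝓝 (f p), w - f p ∈ W → w ∈ f '' O := by
  obtain ⟨L₀, hL₀⟩ := W.exists_isCompl
  let Q : E →L[ℝ] W := (W.projectionOnto L₀ hL₀).toContinuousLinearMap
  have hQ : ∀ x (hx : x ∈ W), Q x = ⟨x, hx⟩ := fun x hx =>
    Submodule.projectionOnto_apply_left hL₀ ⟨x, hx⟩
  have h1 : HasStrictFDerivAt (fun q => Q (f q)) (Q.comp f') p := Q.hasStrictFDerivAt.comp p hf
  have h2 : (Q.comp f').range = ⊤ := by
    rw [LinearMap.range_eq_top]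
    rintro ⟨w, hw⟩
    obtain ⟨u, hu⟩ := hr ▸ hw
    refine ⟨u, ?_⟩
    have hu' : f' u = w := hu
    change Q (f' u) = _
    rw [hu', hQ w hw]
  have h3 := h1.map_nhds_eq_of_surj h2
  have h4 : (fun q => Q (f q)) '' (O ∩ {q | f q - f p ∈ W}) ∈ 𝓝 (Q (f p)) := by
    rw [← h3]
    exact image_mem_map (inter_mem hO hW)
  filter_upwards [Q.continuous.continuousAt h4]
  rintro w ⟨q, ⟨hqO, hq⟩, hqw⟩ hw
  refine ⟨q, hqO, ?_⟩
  have h5 : f q - w ∈ W := by simpa using sub_mem (show f q - f p ∈ W from hq) hw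
  have h6 := hQ _ h5
  rw [map_sub, show Q (f q) = Q w from hqw, sub_self] at h6
  exact sub_eq_zero.mp (congrArg Subtype.val h6).symm

end Submodule

/-! ### Leaves as images of subspaces, and their compactness -/

section Leaves

variable {n : ℕ} {M : Type u} [TopologicalSpace M] [ChartedSpace (𝔼 n) M]
  [IsManifold (𝓡 n) ∞ M] [RiemannianBundle (fun x : M => TangentSpace (𝓡 n) x)]
  {φ ψ : 𝔼 n → M} {D : (x : M) → Submodule ℝ (TangentSpace (𝓡 n) x)} {W : Submodule ℝ (𝔼 n)}

theorem IsDevelopingOn.contMDiff (hφ : IsDevelopingOn φ Set.univ) :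
    ContMDiff (𝓡 n) (𝓡 n) ∞ φ := fun v => by
  obtain ⟨e, he, hv, heq⟩ := hφ v (Set.mem_univ v)
  exact he.contMDiffAt_of_eventuallyEq hv heq

theorem IsDevelopingOn.devDeriv_bijective (hφ : IsDevelopingOn φ Set.univ) (v : 𝔼 n) :
    Function.Bijective (devDeriv φ v) := by
  obtain ⟨e, he, hv, heq⟩ := hφ v (Set.mem_univ v)
  exact Function.bijective_iff_has_inverse.mpr ⟨chartDeriv e (φ v), he.chartDeriv_devDeriv hv heq,
    he.devDeriv_chartDeriv hv heq⟩

theorem PullsBackTo.map_eq (hφ : IsDevelopingOn φ Set.univ) (hW : PullsBackTo φ D W) (v : 𝔼 n) :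
    W.map (devDeriv φ v).toLinearMap = D (φ v) := by
  ext x
  obtain ⟨u, rfl⟩ := (hφ.devDeriv_bijective v).2 x
  rw [hW]
  exact (hφ.devDeriv_bijective v).1.mem_set_image

theorem PullsBackTo.iSup (hφ : IsDevelopingOn φ Set.univ) {J : Type*}
    {D : J → (x : M) → Submodule ℝ (TangentSpace (𝓡 n) x)} {W : J → Submodule ℝ (𝔼 n)}
    (h : ∀ j, PullsBackTo φ (D j) (W j)) :
    PullsBackTo φ (fun x => ⨆ j, D j x) (⨆ j, W j) := by
  intro v u
  have : (⨆ j, W j).map (devDeriv φ v).toLinearMap = ⨆ j, D j (φ v) := by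
    rw [Submodule.map_iSup]
    exact iSup_congr fun j => (h j).map_eq hφ v
  change devDeriv φ v u ∈ ⨆ j, D j (φ v) ↔ _
  rw [← this]
  exact (hφ.devDeriv_bijective v).1.mem_set_image

theorem PullsBackTo.iInf {J : Type*} {D : J → (x : M) → Submodule ℝ (TangentSpace (𝓡 n) x)}
    {W : J → Submodule ℝ (𝔼 n)} (h : ∀ j, PullsBackTo φ (D j) (W j)) :
    PullsBackTo φ (fun x => ⨅ j, D j x) (⨅ j, W j) := by
  intro v u
  simp only [Submodule.mem_iInf]
  exact forall_congr' fun j => h j v u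

theorem PullsBackTo.linear_mem_iff (hψ : IsDevelopingOn ψ Set.univ) {W' : Submodule ℝ (𝔼 n)}
    (hW : PullsBackTo φ D W) (hW' : PullsBackTo ψ D W') {g : 𝔼 n ≃ᵃⁱ[ℝ] 𝔼 n}
    (hg : ∀ v, ψ (g v) = φ v) (w : 𝔼 n) : g.linearIsometryEquiv w ∈ W' ↔ w ∈ W := by
  obtain rfl : φ = ψ ∘ g := funext fun v => (hg v).symm
  rw [← hW 0 w, ← hW' (g 0)]
  have h1 : mfderiv (𝓡 n) (𝓡 n) (ψ ∘ g) 0 = (mfderiv (𝓡 n) (𝓡 n) ψ (g 0)).comp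
      (g.linearIsometryEquiv.toContinuousLinearEquiv : 𝔼 n →L[ℝ] 𝔼 n) :=
    ((hψ.contMDiff.mdifferentiableAt (by simp)).hasMFDerivAt.comp 0
      (hasFDerivAt_isometry g 0).hasMFDerivAt).mfderiv
  have h2 : devDeriv (ψ ∘ g) 0 w = devDeriv ψ (g 0) (g.linearIsometryEquiv w) :=
    DFunLike.congr_fun h1 w
  rw [h2]
  rfl

theorem PullsBackTo.isHolonomyInvariant (hφ : IsDevelopingOn φ Set.univ)
    (hW : PullsBackTo φ D W) : IsHolonomyInvariant φ W :=
  fun _ hg w hw => (hW.linear_mem_iff hφ hW hg w).mpr hw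

variable {k : ℕ} {N : Type u} [TopologicalSpace N] [ChartedSpace (𝔼 k) N] {ι : N → M}

/-- An integral manifold lifts locally to a developing map, where it is an open part of an affine
subspace. -/
theorem IsConnectedIntegralManifold.exists_lift (hι : IsConnectedIntegralManifold D k ι)
    (hφ : IsDevelopingOn φ Set.univ) (hW : PullsBackTo φ D W) {p : N} {v : 𝔼 n}
    (hpv : ι p = φ v) : ∃ h : N → 𝔼 n,
      (∀ᶠ z in 𝓝 p, φ (h z) = ι z ∧ h z - v ∈ W) ∧
      ∀ O ∈ 𝓝 p, ∀ᶠ w in 𝓝 v, w - v ∈ W → w ∈ h '' O := by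
  have hN := hι.isManifold
  obtain ⟨e, he, hv, heq⟩ := hφ v (Set.mem_univ v)
  have hev : e (ι p) = v := by rw [hpv, heq.self_of_nhds, e.right_inv hv]
  have hps : ι p ∈ e.source := by rw [hpv]; exact mem_source_of_eventuallyEq hv heq
  have hgood : ∀ᶠ z in 𝓝 p, ι z ∈ e.source ∧ φ =ᶠ[𝓝 (e (ι z))] e.symm := by
    have h1 : ContinuousAt ι p := hι.smooth.continuous.continuousAt
    refine (h1.eventually_mem (e.open_source.mem_nhds hps)).and ?_
    have h2 : ContinuousAt (e ∘ ι) p := (e.continuousAt hps).comp h1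
    exact h2.eventually (by rw [Function.comp_apply, hev]; exact eventually_eventuallyEq_nhds.mpr heq)
  let c := chartAt (𝔼 k) p
  have hpc : p ∈ c.source := mem_chart_source _ p
  have hcm : c ∈ IsManifold.maximalAtlas (𝓡 k) ∞ N := IsManifold.chart_mem_maximalAtlas p
  have hct := c.map_source hpc
  let f : 𝔼 k → 𝔼 n := fun q => e (ι (c.symm q))
  have hfp : f (c p) = v := by simp only [f, c.left_inv hpc, hev]
  have hball : ∀ᶠ q in 𝓝 (c p), q ∈ c.target ∧ ι (c.symm q) ∈ e.source ∧
      φ =ᶠ[𝓝 (e (ι (c.symm q)))] e.symm :=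
    (c.open_target.eventually_mem hct).and
      ((c.continuousAt_symm hct).eventually (by rwa [c.left_inv hpc]))
  obtain ⟨r, hr, hball⟩ := Metric.mem_nhds_iff.mp hball
  have hfs : ∀ q ∈ Metric.ball (c p) r, ContDiffAt ℝ ∞ f q := fun q hq =>
    ((he.contMDiffAt (hball hq).2.1).comp q (hι.smooth.contMDiffAt.comp q
      (contMDiffAt_symm_of_mem_maximalAtlas hcm (hball hq).1))).contDiffAt
  -- Read in `c` and `e`, the integral manifold has the constant tangent space `W`, so it stays in
  -- the translate `v + W` and fills a neighbourhood of `v` there.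
  have hfr : ∀ q ∈ Metric.ball (c p) r, LinearMap.range (fderiv ℝ f q).toLinearMap = W := by
    intro q hq
    have hcd : c.MDifferentiable (𝓡 k) (𝓡 k) := mdifferentiable_chart p
    have h1 : fderiv ℝ f q = (chartDeriv e (ι (c.symm q))).comp
        ((mfderiv (𝓡 k) (𝓡 n) ι (c.symm q)).comp (mfderiv (𝓡 k) (𝓡 k) c.symm q)) := by
      rw [← mfderiv_eq_fderiv]
      exact (((he.contMDiffAt (hball hq).2.1).mdifferentiableAt (by simp)).hasMFDerivAt.comp q
        ((hι.smooth.mdifferentiableAt (by simp)).hasMFDerivAt.comp q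
          (hcd.mdifferentiableAt_symm (hball hq).1).hasMFDerivAt)).mfderiv
    have h2 := hι.tangent (c.symm q)
    have h3 := hW.mem_iff he (hball hq).2.1 (hball hq).2.2
    have h4 := (hcd.symm.mfderiv_bijective (hball hq).1).2
    rw [h1]
    ext x
    constructor
    · rintro ⟨u, rfl⟩
      refine (h3 _).mp ?_
      rw [← h2]
      exact ⟨_, rfl⟩
    · intro hx
      obtain ⟨y, rfl⟩ := (he.chartDeriv_bijective (hball hq).2.1).2 x
      have h5 := (h3 y).mpr hx
      rw [← h2] at h5
      obtain ⟨z, rfl⟩ := h5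
      obtain ⟨u, rfl⟩ := h4 z
      exact ⟨u, rfl⟩
  have hcb := Metric.mem_ball_self (x := c p) hr
  have hfW : ∀ q ∈ Metric.ball (c p) r, f q - v ∈ W := fun q hq => by
    rw [← hfp]
    refine sub_mem_of_fderiv_mem Metric.isOpen_ball (convex_ball _ _)
      (fun x hx => (hfs x hx).differentiableAt (by simp)) (fun x hx u => ?_) hcb hq
    rw [← hfr x hx]
    exact ⟨u, rfl⟩
  refine ⟨e ∘ ι, ?_, fun O hO => ?_⟩
  · have h1 := (c.continuousAt hpc).eventually_mem (Metric.isOpen_ball.mem_nhds hcb)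
    filter_upwards [hgood, h1, c.open_source.mem_nhds hpc] with z hz hzb hzc
    refine ⟨?_, ?_⟩
    · rw [Function.comp_apply, hz.2.self_of_nhds, e.left_inv hz.1]
    · have := hfW _ hzb
      simp only [f, c.left_inv hzc] at this
      exact this
  · have h1 : c.symm ⁻¹' O ∈ 𝓝 (c p) := (c.continuousAt_symm hct) (by rwa [c.left_inv hpc])
    have h2 := eventually_mem_image_of_range_eq
      ((hfs _ hcb).hasStrictFDerivAt (by simp)) (hfr _ hcb)
      (by
        filter_upwards [Metric.isOpen_ball.mem_nhds hcb] with q hq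
        rw [hfp]
        exact hfW q hq) h1
    rw [hfp] at h2
    filter_upwards [h2] with w hw hwW
    obtain ⟨q, hq, rfl⟩ := hw hwW
    exact ⟨c.symm q, hq, rfl⟩

/-- Developing maps exist at every point, and `D` is constant in each of them. -/
def IsDeveloped (D : (x : M) → Submodule ℝ (TangentSpace (𝓡 n) x)) : Prop :=
  ∀ x, ∃ φ : 𝔼 n → M, IsDevelopingOn φ Set.univ ∧ φ 0 = x ∧ ∃ W, PullsBackTo φ D W

variable [T2Space M]

/-- The preimage of `φ '' W` in `N` is clopen. For closedness a point outside is developed by its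
own `ψ`: a nearby point inside would supply an isometry from `ψ` to `φ` matching the two subspaces
and so put `ι p` in `φ '' W`. -/
theorem IsConnectedIntegralManifold.range_subset (hι : IsConnectedIntegralManifold D k ι)
    (hD : IsDeveloped D) (hφ : IsDevelopingOn φ Set.univ) (hW : PullsBackTo φ D W)
    {p₀ : N} (hp₀ : ι p₀ ∈ φ '' W) : Set.range ι ⊆ φ '' W := by
  have := hι.connected
  suffices h : ι ⁻¹' (φ '' W) = Set.univ by
    rintro _ ⟨p, rfl⟩
    exact h.ge (Set.mem_univ p)
  refine IsClopen.eq_univ ⟨?_, ?_⟩ ⟨p₀, hp₀⟩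
  · rw [← isOpen_compl_iff, isOpen_iff_mem_nhds]
    intro p hp
    obtain ⟨ψ, hψ, hψ0, W', hW'⟩ := hD (ι p)
    obtain ⟨h, hh, -⟩ := hι.exists_lift hψ hW' hψ0.symm
    filter_upwards [hh]
    rintro z ⟨hz, hzW⟩ ⟨w, hw, hwz⟩
    obtain ⟨g, hg, hgw⟩ := hψ.exists_isometry hφ (hz.trans hwz.symm)
    refine hp ⟨g 0, ?_, by rw [hg, hψ0]⟩
    rw [isometry_apply_eq g (h z) 0, hgw]
    refine add_mem ((hW'.linear_mem_iff hφ hW hg _).mpr ?_) hw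
    rw [zero_sub]
    rw [sub_zero] at hzW
    exact neg_mem hzW
  · rw [isOpen_iff_mem_nhds]
    rintro p ⟨w, hw, hwp⟩
    obtain ⟨h, hh, -⟩ := hι.exists_lift hφ hW hwp.symm
    filter_upwards [hh]
    rintro z ⟨hz, hzW⟩
    exact ⟨h z, by simpa using add_mem hzW hw, hz⟩

/-- The manifold is the image of `φ` restricted to `W`, with `W` identified isometrically with a
Euclidean space. The projection onto it is open, so compactness yields a bounded set of
representatives. -/
theorem exists_isConnectedIntegralManifold (hφ : IsDevelopingOn φ Set.univ)
    (hW : PullsBackTo φ D W) : ∃ (k : ℕ) (N : Type u) (_ : TopologicalSpace N)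
      (_ : ChartedSpace (𝔼 k) N) (ι : N → M), IsConnectedIntegralManifold D k ι ∧
        Set.range ι = φ '' W ∧ (CompactSpace N → IsCobounded φ W) := by
  let b := stdOrthonormalBasis ℝ W
  let j : 𝔼 (Module.finrank ℝ W) →ₗᵢ[ℝ] 𝔼 n := W.subtypeₗᵢ.comp b.repr.symm.toLinearIsometry
  have hj : ∀ w ∈ W, ∃ a, j a = w := fun w hw =>
    ⟨b.repr ⟨w, hw⟩, by simp [j]⟩
  have hjW : ∀ a, j a ∈ W := fun a => (b.repr.symm a).2
  have hjr : LinearMap.range j.toLinearMap = W :=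
    le_antisymm (by rintro _ ⟨a, rfl⟩; exact hjW a) (fun w hw => hj w hw)
  have hψ : IsHomogeneous (φ ∘ j) := hφ.isHomogeneous.comp_linearIsometry j (by
    rw [hjr]; exact hW.isHolonomyInvariant hφ)
  have hjs : ContMDiff (𝓡 _) (𝓡 n) ∞ j := j.contDiff.contMDiff
  have hder : ∀ a, mfderiv (𝓡 _) (𝓡 n) (φ ∘ j) a =
      (mfderiv (𝓡 n) (𝓡 n) φ (j a)).comp j.toContinuousLinearMap := fun a =>
    ((hφ.contMDiff.mdifferentiableAt (by simp)).hasMFDerivAt.comp a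
      j.toContinuousLinearMap.hasFDerivAt.hasMFDerivAt).mfderiv
  let := ImageManifold.chartedSpace hψ
  refine ⟨_, ImageManifold (φ ∘ j), inferInstance, ImageManifold.chartedSpace hψ,
    ImageManifold.incl (φ ∘ j), ImageManifold.isConnectedIntegralManifold hψ
      (hφ.contMDiff.comp hjs) (fun a => ?_) (fun a => ?_), ?_, fun hc => ?_⟩
  · rw [hder]
    exact (hφ.devDeriv_bijective (j a)).1.comp j.injective
  · rw [hder, Function.comp_apply, ← hW.map_eq hφ]
    ext x
    constructor
    · rintro ⟨u, rfl⟩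
      exact ⟨j u, hjW u, rfl⟩
    · rintro ⟨w, hw, rfl⟩
      obtain ⟨u, rfl⟩ := hj w hw
      exact ⟨u, rfl⟩
  · rw [ImageManifold.range_incl]
    ext x
    constructor
    · rintro ⟨a, rfl⟩
      exact ⟨j a, hjW a, rfl⟩
    · rintro ⟨w, hw, rfl⟩
      obtain ⟨a, rfl⟩ := hj w hw
      exact ⟨a, rfl⟩
  · obtain ⟨R, hR⟩ := exists_norm_le_of_isCompact_range (ImageManifold.isOpenMap_proj hψ)
      (by rw [ImageManifold.proj_surjective.range_eq]; exact isCompact_univ)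
    refine ⟨R, fun w hw => ?_⟩
    obtain ⟨a, rfl⟩ := hj w hw
    obtain ⟨u, hu, hua⟩ := hR a
    exact ⟨j u, hjW u, by rwa [j.norm_map], ImageManifold.proj_eq_iff (ψ := φ ∘ j) |>.mp hua⟩

theorem IsConnectedIntegralManifold.isLeaf (hι : IsConnectedIntegralManifold D k ι)
    (hD : IsDeveloped D) (hφ : IsDevelopingOn φ Set.univ) (hW : PullsBackTo φ D W)
    (hr : Set.range ι = φ '' W) : IsLeaf D k ι := by
  refine ⟨hι, fun {l N' _ _} ι' hι' hsub => hsub.antisymm' ?_⟩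
  have h0 : φ 0 ∈ Set.range ι' := hsub (hr ▸ ⟨0, W.zero_mem, rfl⟩)
  obtain ⟨p, hp⟩ := h0
  rw [hr]
  exact hι'.range_subset hD hφ hW (p₀ := p) ⟨0, W.zero_mem, hp.symm⟩

theorem AllLeavesCompact.isCobounded (h : AllLeavesCompact D) (hD : IsDeveloped D)
    (hφ : IsDevelopingOn φ Set.univ) (hW : PullsBackTo φ D W) : IsCobounded φ W := by
  obtain ⟨k, N, _, _, ι, hι, hr, hc⟩ := exists_isConnectedIntegralManifold hφ hW
  exact hc (h k N ι (hι.isLeaf hD hφ hW hr))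

/-- Injectivity of `ι` lifts `φ` on `W` to a map `s` into `N`. It is continuous because small
neighbourhoods in `N` already cover neighbourhoods in `W`, and coboundedness makes `N` the image of
a closed ball. -/
theorem IsConnectedIntegralManifold.compactSpace (hι : IsConnectedIntegralManifold D k ι)
    (hφ : IsDevelopingOn φ Set.univ) (hW : PullsBackTo φ D W) (hr : Set.range ι = φ '' W)
    (hc : IsCobounded φ W) : CompactSpace N := by
  have hex : ∀ w : W, ∃ p, ι p = φ w := fun w => by
    have : φ w ∈ Set.range ι := hr ▸ ⟨w, w.2, rfl⟩
    exact this
  choose s hs using hex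
  have hcont : Continuous s := by
    rw [continuous_iff_continuousAt]
    intro w O hO
    obtain ⟨h, hh, hopen⟩ := hι.exists_lift hφ hW (hs w)
    have h1 := hopen _ (inter_mem hO hh)
    have h2 := continuous_subtype_val.continuousAt (x := w) |>.eventually h1
    rw [mem_map]
    filter_upwards [h2] with w' hw'
    obtain ⟨z, ⟨hzO, hz, -⟩, hzw⟩ := hw' (sub_mem w'.2 w.2)
    have : s w' = z := hι.injective (by rw [hs, ← hz, hzw])
    rwa [Set.mem_preimage, this]
  obtain ⟨R, hR⟩ := hc
  refine ⟨?_⟩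
  convert (isCompact_closedBall (0 : W) R).image hcont
  symm
  rw [Set.eq_univ_iff_forall]
  intro p
  obtain ⟨w, hw, hwp⟩ : ι p ∈ φ '' W := hr ▸ ⟨p, rfl⟩
  obtain ⟨u, hu, hun, hue⟩ := hR w hw
  refine ⟨⟨u, hu⟩, by simpa using hun, hι.injective ?_⟩
  rw [hs, hue, hwp]

/-- Any leaf lies in the image `φ '' W` through one of its points, and this image is an integral
manifold, so maximality gives equality. -/
theorem allLeavesCompact_of_isCobounded (hD : IsDeveloped D)
    (h : ∀ (φ : 𝔼 n → M) (W : Submodule ℝ (𝔼 n)), IsDevelopingOn φ Set.univ →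
      PullsBackTo φ D W → IsCobounded φ W) : AllLeavesCompact D := by
  intro k N _ _ ι hι
  have := hι.connected
  obtain ⟨p⟩ := this.toNonempty
  obtain ⟨φ, hφ, hφ0, W, hW⟩ := hD (ι p)
  have hsub := hι.range_subset hD hφ hW (p₀ := p) ⟨0, W.zero_mem, hφ0⟩
  obtain ⟨l, N', _, _, ι', hι', hr, -⟩ := exists_isConnectedIntegralManifold hφ hW
  have hr' : Set.range ι = φ '' W := by
    rw [← hι.maximal ι' hι' (hr ▸ hsub), hr]
  exact hι.toIsConnectedIntegralManifold.compactSpace hφ hW hr' (h φ W hφ hW)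

theorem IsDeveloped.isParallelWithCompactLeaves (hD : IsDeveloped D)
    (h : ∀ (φ : 𝔼 n → M) (W : Submodule ℝ (𝔼 n)), IsDevelopingOn φ Set.univ →
      PullsBackTo φ D W → IsCobounded φ W) : IsParallelWithCompactLeaves D :=
  ⟨isDistribution_of_pullsBackTo hD, isParallel_of_pullsBackTo hD,
    allLeavesCompact_of_isCobounded hD h⟩

theorem PullsBackTo.unique {W' : Submodule ℝ (𝔼 n)} (h : PullsBackTo φ D W)
    (h' : PullsBackTo φ D W') : W = W' :=
  Submodule.ext fun u => (h 0 u).symm.trans (h' 0 u)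

end Leaves

end FlatManifold

end

end

/-! ### The closure theorem -/

theorem mainTheorem6 {n : ℕ} {M : Type u} [TopologicalSpace M] [T2Space M] [CompactSpace M]
    [ChartedSpace (EuclideanSpace ℝ (Fin n)) M] [IsManifold (𝓡 n) ∞ M]
    [RiemannianBundle (fun x : M => TangentSpace (𝓡 n) x)]
    [IsContMDiffRiemannianBundle (𝓡 n) ∞ (EuclideanSpace ℝ (Fin n))
      (fun x : M => TangentSpace (𝓡 n) x)]
    (hflat : FlatManifold.IsFlat n M)
    {J : Type*} (D : J → (x : M) → Submodule ℝ (TangentSpace (𝓡 n) x))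
    (hD : ∀ j, FlatManifold.IsParallelWithCompactLeaves (D j)) :
    FlatManifold.IsParallelWithCompactLeaves (fun x => ⨆ j, D j x) ∧
      FlatManifold.IsParallelWithCompactLeaves (fun x => ⨅ j, D j x) := by
  open FlatManifold in
  have hW : ∀ φ : EuclideanSpace ℝ (Fin n) → M, IsDevelopingOn φ Set.univ → ∀ j,
      ∃ W, PullsBackTo φ (D j) W := fun φ hφ j =>
    hφ.exists_pullsBackTo (hD j).isDistribution (hD j).isParallel
  have hdev : ∀ j, IsDeveloped (D j) := fun j x => by
    obtain ⟨φ, hφ, hx⟩ := exists_isDevelopingOn_univ hflat x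
    exact ⟨φ, hφ, hx, hW φ hφ j⟩
  have hb : ∀ (φ : EuclideanSpace ℝ (Fin n) → M), IsDevelopingOn φ Set.univ → ∀ j W,
      PullsBackTo φ (D j) W → IsHolonomyInvariant φ W ∧ IsCobounded φ W := fun φ hφ j W h =>
    ⟨h.isHolonomyInvariant hφ, (hD j).allLeavesCompact.isCobounded (hdev j) hφ h⟩
  constructor
  · refine IsDeveloped.isParallelWithCompactLeaves (fun x => ?_) fun φ V hφ hV => ?_
    · obtain ⟨φ, hφ, hx⟩ := exists_isDevelopingOn_univ hflat x
      choose W h using hW φ hφ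
      exact ⟨φ, hφ, hx, _, PullsBackTo.iSup hφ h⟩
    · choose W h using hW φ hφ
      -- The subspace to which a distribution pulls back is determined by `φ`, so `V` is the
      -- supremum of the `W j`.
      rw [hV.unique (PullsBackTo.iSup hφ h)]
      exact IsCobounded.iSup hφ.isHomogeneous (fun j => (hb φ hφ j _ (h j)).1)
        fun j => (hb φ hφ j _ (h j)).2
  · refine IsDeveloped.isParallelWithCompactLeaves (fun x => ?_) fun φ V hφ hV => ?_
    · obtain ⟨φ, hφ, hx⟩ := exists_isDevelopingOn_univ hflat x
      choose W h using hW φ hφ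
      exact ⟨φ, hφ, hx, _, PullsBackTo.iInf h⟩
    · choose W h using hW φ hφ
      rw [hV.unique (PullsBackTo.iInf h)]
      exact IsCobounded.iInf hφ.isHomogeneous (hφ.isCobounded_top hflat)
        (fun j => (hb φ hφ j _ (h j)).1) fun j => (hb φ hφ j _ (h j)).2
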